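/- A magma is a set with a binary operation $\diamond$. An equational law $w_1\simeq w_2$ is a pair of words in $\diamond$ and indeterminates $0,1,2,\dots$; its order is the total number of occurrences of $\diamond$ in it. A magma satisfies the law (is a model of it) if the two sides agree under every assignment of the indeterminates. The spectrum of a law is the set of cardinalities of its finite nonempty models; the law has full spectrum if its spectrum is $\mathbb{Z}_{>0}$. The dual of a law is obtained by reversing all operations. Words in a single indeterminate are totally ordered by comparing first the order, then the left factor, then the right factor. Laws are totally ordered by comparing first the order of the law, then the shapes (all indeterminates replaced by one and the same) of the left-hand sides, then the shapes of the right-hand sides, then, lexicographically, the strings of indeterminates read from left to right. Two laws are definitionally equivalent if one arises from the other by renaming the indeterminates and possibly exchanging the sides. List the least element of every class of definitionally equivalent laws, omitting all laws $w\simeq w$ other than $0\simeq 0$, and let $E_k$ be the $k$-th law of the list in increasing order. Exactly $4694$ listed laws have order at most $4$. Writing $x,y,z$ for $0,1,2$, one has $$E_{1482}:\ x\simeq (y\diamond x)\diamond(x\diamond(y\diamond y)),\qquad E_{1523}:\ x\simeq (y\diamond y)\diamond(x\diamond(z\diamond z)),\qquad E_{1682}:\ x\simeq (y\diamond x)\diamond((x\diamond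 x)\diamond y).$$ Among the $4694$ laws, exactly $3074$ have full spectrum and the remaining $1620$ do not. Moreover: 1. One of these laws has full spectrum if and only if either (a) there are fixed $a,b\in\{-1,0,1\}$ such that for every $n\ge 1$ the operation $x\diamond y=ax+by$ on $\mathbb{Z}/n\mathbb{Z}$ is a model of it, or (b) up to definitional equivalence it is $E_{1482}$, $E_{1523}$, $E_{1682}$ or the dual of one of these. Cases (a) and (b) exclude each other; exactly $3068$ of the laws are of type (a) and exactly $6$ are of type (b). 2. One of these laws fails to have full spectrum if and only if it has no model of size $2$ or no model of size $3$. Exactly $1558$ of the laws have no model of size $2$, and exactly $62$ have a model of size $2$ but none of size $3$. -/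

import Mathlib

/-- An equational law `lhs ≃ rhs`: a pair of words in the magma operation, written `*`, with
indeterminates `0, 1, 2, …`. -/
structure MagmaLaw where
  lhs : FreeMagma ℕ
  rhs : FreeMagma ℕ

namespace MagmaLaw

/-! ### Satisfaction and spectrum -/

/-- The value of a word in the magma `(M, op)` under an assignment of the indeterminates. -/
def wordValue {M : Type} (op : M → M → M) (f : ℕ → M) : FreeMagma ℕ → M
  | .of i => f i
  | .mul u v => op (wordValue op f u) (wordValue op f v)

/-- The magma `(M, op)` satisfies the law `L`. -/
def SatisfiedBy {M : Type} (op : M → M → M) (L : MagmaLaw) : Prop :=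
  ∀ f : ℕ → M, wordValue op f L.lhs = wordValue op f L.rhs

/-- The set of sizes of the finite nonempty models of `L`. -/
def spectrum (L : MagmaLaw) : Set ℕ :=
  {n | 0 < n ∧ ∃ (M : Type) (_ : Finite M) (op : M → M → M), Nat.card M = n ∧ L.SatisfiedBy op}

/-- `L` has models of every positive finite size. -/
def HasFullSpectrum (L : MagmaLaw) : Prop :=
  L.spectrum = {n | 0 < n}

/-- For some fixed `a, b ∈ {-1, 0, 1}`, the operation `a x + b y` on `ℤ/nℤ` is a model of `L` for
every `n ≥ 1`. -/
def HasLinearModels (L : MagmaLaw) : Prop :=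
  ∃ a ∈ ({-1, 0, 1} : Set ℤ), ∃ b ∈ ({-1, 0, 1} : Set ℤ), ∀ n : ℕ, 1 ≤ n →
    L.SatisfiedBy (fun x y : ZMod n => (a : ZMod n) * x + (b : ZMod n) * y)

/-! ### The list of laws -/

/-- The order of a word: the number of occurrences of the operation. -/
def wordOrder {α : Type} : FreeMagma α → ℕ
  | .of _ => 0
  | .mul u v => wordOrder u + wordOrder v + 1

/-- The indeterminates of a word, from left to right. -/
def wordVars : FreeMagma ℕ → List ℕ
  | .of i => [i]
  | .mul u v => wordVars u ++ wordVars v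

/-- The shape of a word: all indeterminates are replaced by a single one. -/
def wordShape (w : FreeMagma ℕ) : FreeMagma Unit :=
  FreeMagma.map (fun _ => ()) w

/-- The strict order on words in a single indeterminate: first by order, then by the left factor,
then by the right factor. -/
def ShapeLT : FreeMagma Unit → FreeMagma Unit → Prop
  | .of _, .of _ => False
  | .of _, .mul _ _ => True
  | .mul _ _, .of _ => False
  | .mul u v, .mul u' v' =>
      wordOrder u + wordOrder v < wordOrder u' + wordOrder v' ∨
      (wordOrder u + wordOrder v = wordOrder u' + wordOrder v' ∧
        (ShapeLT u u' ∨ (u = u' ∧ ShapeLT v v')))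

/-- The order of a law: the total number of occurrences of the operation. -/
def order (L : MagmaLaw) : ℕ := wordOrder L.lhs + wordOrder L.rhs

/-- The indeterminates of a law, from left to right. -/
def vars (L : MagmaLaw) : List ℕ := wordVars L.lhs ++ wordVars L.rhs

/-- `L` and `L'` have the same shape. -/
def SameShape (L L' : MagmaLaw) : Prop :=
  wordShape L.lhs = wordShape L'.lhs ∧ wordShape L.rhs = wordShape L'.rhs

/-- The strict order on laws: first by order, then by the shape of the left-hand side, then by the
shape of the right-hand side, then lexicographically by the string of indeterminates. -/
def LT (L L' : MagmaLaw) : Prop :=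
  L.order < L'.order ∨
  (L.order = L'.order ∧
    (ShapeLT (wordShape L.lhs) (wordShape L'.lhs) ∨
      (wordShape L.lhs = wordShape L'.lhs ∧ ShapeLT (wordShape L.rhs) (wordShape L'.rhs)))) ∨
  (L.SameShape L' ∧ L.vars < L'.vars)

/-- Renaming the indeterminates. -/
def relabel (σ : Equiv.Perm ℕ) (L : MagmaLaw) : MagmaLaw :=
  ⟨FreeMagma.map σ L.lhs, FreeMagma.map σ L.rhs⟩

/-- Exchanging the two sides. -/
def symm (L : MagmaLaw) : MagmaLaw := ⟨L.rhs, L.lhs⟩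

/-- Definitional equivalence: `L'` arises from `L` by renaming the indeterminates and possibly
exchanging the two sides. -/
def DefEquiv (L L' : MagmaLaw) : Prop :=
  ∃ σ : Equiv.Perm ℕ, L' = L.relabel σ ∨ L' = L.symm.relabel σ

/-- The laws that are listed: the least member of each class of definitional equivalence, where of
all the laws `w ≃ w` only `0 ≃ 0` is kept. -/
def IsListed (L : MagmaLaw) : Prop :=
  (∀ L', L.DefEquiv L' → ¬ L'.LT L) ∧ (L.lhs = L.rhs → L = ⟨.of 0, .of 0⟩)

/-- The number of a listed law: its position in the list of all listed laws in increasing order,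
counted from `1`. -/
noncomputable def number (L : MagmaLaw) : ℕ :=
  {L' : MagmaLaw | L'.IsListed ∧ L'.LT L}.ncard + 1

/-- The listed laws of order at most `4`. -/
def lawsUpToFour : Set MagmaLaw := {L | L.IsListed ∧ L.order ≤ 4}

/-! ### Duality and the three exceptional laws -/

/-- The word read in the opposite magma. -/
def dualWord : FreeMagma ℕ → FreeMagma ℕ
  | .of i => .of i
  | .mul u v => .mul (dualWord v) (dualWord u)

/-- The dual law: all operations are reversed. -/
def dual (L : MagmaLaw) : MagmaLaw := ⟨dualWord L.lhs, dualWord L.rhs⟩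

open FreeMagma in
/-- `x ≃ (y ◇ x) ◇ (x ◇ (y ◇ y))` -/
def E1482 : MagmaLaw := ⟨of 0, (of 1 * of 0) * (of 0 * (of 1 * of 1))⟩

open FreeMagma in
/-- `x ≃ (y ◇ y) ◇ (x ◇ (z ◇ z))` -/
def E1523 : MagmaLaw := ⟨of 0, (of 1 * of 1) * (of 0 * (of 2 * of 2))⟩

open FreeMagma in
/-- `x ≃ (y ◇ x) ◇ ((x ◇ x) ◇ y)` -/
def E1682 : MagmaLaw := ⟨of 0, (of 1 * of 0) * ((of 0 * of 0) * of 1)⟩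

/-- `L` is, up to definitional equivalence, one of the three laws above or one of their duals. -/
def IsExceptional (L : MagmaLaw) : Prop :=
  ∃ E ∈ ({E1482, E1523, E1682} : Set MagmaLaw), E.DefEquiv L ∨ E.dual.DefEquiv L

end MagmaLaw

/-! Only finitely many laws are in question, so the theorem reduces to a finite computation once
every law has a checkable certificate for or against full spectrum.

There are two kinds of positive certificate. If both sides of a law have the same integer
coefficients under `a x + b y` with signs `a`, `b`, the operation is a model over every commutative
ring, in particular modulo every `n` (`satisfiedBy_of_linearCheck`). The exceptional laws receive
models of every size by hand: an identity with all squares equal to it for `E1523`, a transposition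
acting from both sides for `E1482`, and a square root of the exchange of coordinates on pairs of
different elements for `E1682`. None of the three, nor a dual, has a linear model modulo 3. The
negative certificate is an exhaustive search for operation tables on two or three elements
(`refute_sound`).

Each test is used in one direction only; that together they miss nothing comes out of the count.
`kind` records which certificate applies, and the evaluation shows that no law is left without one
(`kind_lt`). Since full spectrum entails models of sizes 2 and 3, the conclusions in `kind_spec`
exclude each other, so each kind is exactly the property to be counted.

The list itself is computable because a law is determined by the shapes of its sides and its string
of indeterminates, and the least renaming of a string names the indeterminates by first occurrence.
This turns minimality in a class into a condition on the law alone (`isListed_iff`), by which all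
listed laws of bounded order are generated without repetition (`mem_lawList`, `nodup_lawList`). -/

namespace MagmaLaw

/-! ### Canonical strings of indeterminates -/

/-- Rename the entries of a list by order of first occurrence, where the entries of `s` have
already received the names `0, 1, …`. -/
def canonAux : List ℕ → List ℕ → List ℕ
  | _, [] => []
  | s, x :: t => s.idxOf x :: canonAux (bif s.contains x then s else s ++ [x]) t

/-- Rename the entries of a list by order of first occurrence. -/
def canon (l : List ℕ) : List ℕ := canonAux [] l

/-- When `x` is appended, composing with the transposition of `σ x` and `s.length` puts `x` in
place. Earlier entries are undisturbed: their values differ from `σ x` and are smaller than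
`s.length`. -/
theorem exists_perm_of_nodup (s : List ℕ) (hs : s.Nodup) :
    ∃ σ : Equiv.Perm ℕ, ∀ x ∈ s, σ x = s.idxOf x := by
  induction s using List.reverseRecOn with
  | nil => exact ⟨1, by simp⟩
  | append_singleton s x ih =>
    have hx : x ∉ s := by
      intro h
      exact (List.nodup_append.1 hs).2.2 x h x (by simp) rfl
    obtain ⟨σ, hσ⟩ := ih (List.nodup_append.1 hs).1
    refine ⟨Equiv.swap (σ x) s.length * σ, fun y hy => ?_⟩
    rw [Equiv.Perm.mul_apply]
    rcases List.mem_append.1 hy with h | h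
    · rw [List.idxOf_append_of_mem h, hσ y h]
      apply Equiv.swap_apply_of_ne_of_ne
      · rw [← hσ y h]
        intro e
        exact hx (σ.injective e ▸ h)
      · exact (List.idxOf_lt_length_of_mem h).ne
    · obtain rfl : y = x := by simpa using h
      rw [Equiv.swap_apply_left, List.idxOf_append_of_notMem hx]
      simp

theorem nodup_seen {s : List ℕ} (hs : s.Nodup) (x : ℕ) :
    (bif s.contains x then s else s ++ [x]).Nodup := by
  by_cases h : x ∈ s
  · simpa [h] using hs
  · simp only [List.contains_eq_mem, h, decide_false, cond_false]
    exact List.nodup_append.2 ⟨hs, by simp, fun a ha b hb => by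
      rintro rfl; simp at hb; exact h (hb ▸ ha)⟩

theorem exists_perm_map_eq_canonAux (l : List ℕ) : ∀ s : List ℕ, s.Nodup →
    ∃ σ : Equiv.Perm ℕ, (∀ x ∈ s, σ x = s.idxOf x) ∧ l.map σ = canonAux s l := by
  induction l with
  | nil =>
    intro s hs
    obtain ⟨σ, hσ⟩ := exists_perm_of_nodup s hs
    exact ⟨σ, hσ, rfl⟩
  | cons x t ih =>
    intro s hs
    obtain ⟨σ, hσ, h⟩ := ih _ (nodup_seen hs x)
    refine ⟨σ, ?_⟩
    rw [List.map_cons, h, canonAux]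
    by_cases hx : x ∈ s
    · simp only [List.contains_eq_mem, hx, decide_true, cond_true] at hσ ⊢
      exact ⟨hσ, by rw [hσ x hx]⟩
    · simp only [List.contains_eq_mem, hx, decide_false, cond_false] at hσ ⊢
      refine ⟨fun y hy => ?_, ?_⟩
      · rw [hσ y (by simp [hy]), List.idxOf_append_of_mem hy]
      · rw [hσ x (by simp), List.idxOf_append_of_notMem hx, List.idxOf_eq_length hx]
        simp

/-- At a new indeterminate the canonical name is `s.length`. An injective renaming cannot use a
smaller name there, since all of these are taken by the entries of `s`. -/
theorem not_map_lt_canonAux {f : ℕ → ℕ} (hf : f.Injective) (l : List ℕ) : ∀ s : List ℕ,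
    s.Nodup → (∀ x ∈ s, f x = s.idxOf x) → ¬ l.map f < canonAux s l := by
  induction l with
  | nil => intro s _ _; simp [canonAux]
  | cons x t ih =>
    intro s hn hs
    rw [List.map_cons, canonAux, List.cons_lt_cons_iff]
    have hn' := nodup_seen hn x
    by_cases hx : x ∈ s
    · simp only [List.contains_eq_mem, hx, decide_true, cond_true, hs x hx]
      rintro (h | ⟨-, h⟩)
      · exact lt_irrefl _ h
      · exact ih s hn hs h
    · simp only [List.contains_eq_mem, hx, decide_false, cond_false,
        List.idxOf_eq_length hx] at hn' ⊢
      rintro (h | ⟨he, h⟩)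
      · have hi := hs _ (List.getElem_mem h)
        rw [List.Nodup.idxOf_getElem hn] at hi
        exact hx (hf hi ▸ List.getElem_mem h)
      · refine ih _ hn' (fun y hy => ?_) h
        rcases List.mem_append.1 hy with h' | h'
        · rw [List.idxOf_append_of_mem h', hs y h']
        · obtain rfl : y = x := by simpa using h'
          rw [he, List.idxOf_append_of_notMem hx]
          simp

theorem exists_perm_map_eq_canon (l : List ℕ) : ∃ σ : Equiv.Perm ℕ, l.map σ = canon l := by
  obtain ⟨σ, -, h⟩ := exists_perm_map_eq_canonAux l [] List.nodup_nil
  exact ⟨σ, h⟩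

theorem canon_le_map (σ : Equiv.Perm ℕ) (l : List ℕ) : canon l ≤ l.map σ :=
  not_lt.1 (not_map_lt_canonAux σ.injective l [] List.nodup_nil (by simp))

/-- `canon` yields the least string among all renamings, and a string and its renaming have the same
renamings. -/
theorem canon_map (σ : Equiv.Perm ℕ) (l : List ℕ) : canon (l.map σ) = canon l := by
  apply le_antisymm
  · obtain ⟨τ, hτ⟩ := exists_perm_map_eq_canon l
    have := canon_le_map (σ.symm.trans τ) (l.map σ)
    rw [List.map_map] at this
    have e : (σ.symm.trans τ : ℕ → ℕ) ∘ σ = τ := by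
      ext x
      simp
    rw [e, hτ] at this
    exact this
  · obtain ⟨τ, hτ⟩ := exists_perm_map_eq_canon (l.map σ)
    rw [← hτ, List.map_map]
    exact canon_le_map (σ.trans τ) l

/-! ### A criterion for a law to be listed -/

theorem not_shapeLT_self (s : FreeMagma Unit) : ¬ ShapeLT s s := by
  induction s using FreeMagma.rec with
  | of => simp [ShapeLT]
  | mul u v hu hv =>
    simp [ShapeLT, hu, hv]

theorem wordShape_map (f : ℕ → ℕ) (w : FreeMagma ℕ) :
    wordShape (FreeMagma.map f w) = wordShape w := by
  induction w using FreeMagma.rec with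
  | of => rfl
  | mul u v hu hv => exact congrArg₂ FreeMagma.mul hu hv

theorem wordOrder_wordShape (w : FreeMagma ℕ) : wordOrder (wordShape w) = wordOrder w := by
  induction w using FreeMagma.rec with
  | of => rfl
  | mul u v hu hv =>
    change wordOrder (wordShape u) + wordOrder (wordShape v) + 1 = wordOrder u + wordOrder v + 1
    rw [hu, hv]

theorem wordOrder_map (f : ℕ → ℕ) (w : FreeMagma ℕ) :
    wordOrder (FreeMagma.map f w) = wordOrder w := by
  rw [← wordOrder_wordShape, wordShape_map, wordOrder_wordShape]

theorem wordVars_map (f : ℕ → ℕ) (w : FreeMagma ℕ) :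
    wordVars (FreeMagma.map f w) = (wordVars w).map f := by
  induction w using FreeMagma.rec with
  | of => rfl
  | mul u v hu hv =>
    change wordVars (FreeMagma.map f u) ++ wordVars (FreeMagma.map f v) =
      (wordVars u ++ wordVars v).map f
    rw [hu, hv, List.map_append]

theorem vars_relabel (σ : Equiv.Perm ℕ) (L : MagmaLaw) : (L.relabel σ).vars = L.vars.map σ := by
  simp [vars, relabel, wordVars_map]

theorem order_relabel (σ : Equiv.Perm ℕ) (L : MagmaLaw) : (L.relabel σ).order = L.order := by
  simp [order, relabel, wordOrder_map]

theorem order_symm (L : MagmaLaw) : L.symm.order = L.order := Nat.add_comm _ _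

/-- Renaming changes neither order nor shapes, so within a class only the exchange of sides and the
string matter, and `canon` attains the least string for either arrangement of the sides. -/
theorem isListed_iff (L : MagmaLaw) : L.IsListed ↔
    canon L.vars = L.vars ∧ ¬ ShapeLT (wordShape L.rhs) (wordShape L.lhs) ∧
    (wordShape L.lhs = wordShape L.rhs → ¬ canon L.symm.vars < L.vars) ∧
    (L.lhs = L.rhs → L = ⟨.of 0, .of 0⟩) := by
  constructor
  · rintro ⟨h, h'⟩
    refine ⟨?_, fun hs => ?_, fun hs hv => ?_, h'⟩
    · obtain ⟨σ, hσ⟩ := exists_perm_map_eq_canon L.vars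
      apply le_antisymm
      · simpa using canon_le_map 1 L.vars
      · refine not_lt.1 fun hlt => h (L.relabel σ) ⟨σ, .inl rfl⟩ (.inr (.inr ⟨?_, ?_⟩))
        · simp [SameShape, relabel, wordShape_map]
        · rwa [vars_relabel, hσ]
    · refine h (L.symm.relabel 1) ⟨1, .inr rfl⟩ (.inr (.inl ⟨?_, .inl ?_⟩))
      · rw [order_relabel, order_symm]
      · simpa [relabel, symm, wordShape_map] using hs
    · obtain ⟨σ, hσ⟩ := exists_perm_map_eq_canon L.symm.vars
      refine h (L.symm.relabel σ) ⟨σ, .inr rfl⟩ (.inr (.inr ⟨?_, ?_⟩))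
      · simp [SameShape, relabel, symm, wordShape_map, hs]
      · rwa [vars_relabel, hσ]
  · rintro ⟨h1, h2, h3, h4⟩
    refine ⟨?_, h4⟩
    rintro _ ⟨σ, rfl | rfl⟩ hlt
    · have hl : wordShape (L.relabel σ).lhs = wordShape L.lhs := wordShape_map _ _
      have hr : wordShape (L.relabel σ).rhs = wordShape L.rhs := wordShape_map _ _
      unfold LT SameShape at hlt
      rw [order_relabel, hl, hr, vars_relabel] at hlt
      simp only [lt_irrefl, not_shapeLT_self, and_false, or_false, false_or, true_and] at hlt
      exact absurd (canon_le_map σ L.vars) (not_le.2 (h1.symm ▸ hlt))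
    · have hl : wordShape (L.symm.relabel σ).lhs = wordShape L.rhs := wordShape_map _ _
      have hr : wordShape (L.symm.relabel σ).rhs = wordShape L.lhs := wordShape_map _ _
      unfold LT SameShape at hlt
      rw [order_relabel, order_symm, hl, hr, vars_relabel] at hlt
      rcases hlt with hlt | ⟨-, hlt | ⟨he, hlt⟩⟩ | ⟨⟨he, -⟩, hlt⟩
      · exact lt_irrefl _ hlt
      · exact h2 hlt
      · exact not_shapeLT_self _ (he ▸ hlt)
      · exact h3 he.symm ((canon_le_map σ _).trans_lt hlt)

/-- The shapes and the indeterminates of a listed law that is definitionally equivalent to a given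
law with a single indeterminate on the left-hand side and a product on the right-hand side. -/
theorem eq_of_defEquiv_of_isListed {u v : FreeMagma ℕ} {i : ℕ} {L : MagmaLaw} (hL : L.IsListed)
    (h : DefEquiv ⟨.of i, .mul u v⟩ L) :
    wordShape L.lhs = .of () ∧ wordShape L.rhs = wordShape (.mul u v) ∧
      L.vars = canon (MagmaLaw.vars ⟨.of i, .mul u v⟩) := by
  obtain ⟨h1, h2, -⟩ := (isListed_iff L).1 hL
  obtain ⟨σ, rfl | rfl⟩ := h
  · refine ⟨rfl, wordShape_map _ _, ?_⟩
    rw [← h1, vars_relabel, canon_map]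
  · exact (h2 trivial).elim

/-! ### Enumeration of the listed laws -/

/-- The shapes of order at most `n`. -/
def shapes : ℕ → List (FreeMagma Unit)
  | 0 => [.of ()]
  | n + 1 => .of () :: (shapes n).flatMap fun u =>
      ((shapes n).filter fun v => (wordOrder u + wordOrder v).ble n).map fun v => .mul u v

/-- Completeness is enough here: `shapePairs` bounds the orders anew. -/
theorem mem_shapes {s : FreeMagma Unit} {n : ℕ} (h : wordOrder s ≤ n) : s ∈ shapes n := by
  induction n generalizing s with
  | zero =>
    cases s with
    | of => simp [shapes]
    | mul u v => simp [wordOrder] at h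
  | succ n ih =>
    cases s with
    | of => simp [shapes]
    | mul u v =>
      simp only [wordOrder] at h
      refine List.mem_cons_of_mem _ (List.mem_flatMap.2 ⟨u, ih (by omega), ?_⟩)
      exact List.mem_map.2 ⟨v, List.mem_filter.2
        ⟨ih (by omega), Nat.ble_eq_true_of_le (by omega)⟩, rfl⟩

theorem nodup_shapes (n : ℕ) : (shapes n).Nodup := by
  induction n with
  | zero => simp [shapes]
  | succ n ih =>
    rw [shapes, List.nodup_cons]
    refine ⟨by simp, List.nodup_flatMap.2 ⟨fun u _ => ?_, ?_⟩⟩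
    · exact (ih.filter _).map fun v v' h => by injection h
    · refine ih.imp fun {u u'} hne => ?_
      intro x hx hx'
      obtain ⟨v, -, rfl⟩ := List.mem_map.1 hx
      obtain ⟨v', -, h⟩ := List.mem_map.1 hx'
      exact hne (by injection h with h1; exact h1.symm)

/-- The canonical strings of length `n` that continue a string in which `0, …, k - 1` occur. -/
def canonStrings : ℕ → ℕ → List (List ℕ)
  | 0, _ => [[]]
  | n + 1, k => (List.range (k + 1)).flatMap fun x =>
      (canonStrings n (bif x.blt k then k else k + 1)).map fun l => x :: l

/-- With `List.range k` as the list of names seen so far, every name is its own position, so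
canonical strings are the fixed points of `canonAux`. -/
theorem mem_canonStrings {n : ℕ} : ∀ {k : ℕ} {l : List ℕ}, l ∈ canonStrings n k ↔
    l.length = n ∧ canonAux (List.range k) l = l := by
  induction n with
  | zero =>
    intro k l
    simp only [canonStrings, List.mem_singleton, List.length_eq_zero_iff]
    exact ⟨fun h => ⟨h, by rw [h, canonAux]⟩, fun h => h.1⟩
  | succ n ih =>
    intro k l
    cases l with
    | nil => simp [canonStrings]
    | cons x t =>
      have key : x :: t ∈ canonStrings (n + 1) k ↔
          x < k + 1 ∧ t ∈ canonStrings n (bif x.blt k then k else k + 1) := by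
        simp [canonStrings]
      rw [key, ih, canonAux]
      simp only [List.length_cons, Nat.add_right_cancel_iff, List.cons.injEq]
      by_cases hx : x < k
      · have h1 : x ∈ List.range k := List.mem_range.2 hx
        have h2 : (List.range k).idxOf x = x := by
          have := List.Nodup.idxOf_getElem (List.nodup_range (n := k)) x (by simpa using hx)
          simpa using this
        have h3 : x.blt k = true := by simpa [Nat.blt_eq] using hx
        simp only [List.contains_eq_mem, h1, decide_true, cond_true, h2, h3, true_and]
        exact ⟨fun h => h.2, fun h => ⟨by omega, h⟩⟩
      · have h1 : x ∉ List.range k := by simpa using hx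
        have h2 : (List.range k).idxOf x = k := by
          rw [List.idxOf_eq_length h1, List.length_range]
        have h3 : x.blt k = false := by
          rw [Bool.eq_false_iff, Ne, Nat.blt_eq]; exact hx
        simp only [List.contains_eq_mem, h1, decide_false, cond_false, h2, h3]
        constructor
        · rintro ⟨h, hl, hc⟩
          obtain rfl : x = k := by omega
          exact ⟨hl, rfl, by rwa [← List.range_succ]⟩
        · rintro ⟨hl, rfl, hc⟩
          exact ⟨by omega, hl, by rwa [List.range_succ]⟩

theorem nodup_canonStrings (n : ℕ) : ∀ k, (canonStrings n k).Nodup := by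
  induction n with
  | zero => intro k; simp [canonStrings]
  | succ n ih =>
    intro k
    refine List.nodup_flatMap.2 ⟨fun x _ => (ih _).map fun l l' h => by injection h, ?_⟩
    refine List.nodup_range.imp fun {x y} hne l hl hl' => ?_
    obtain ⟨t, -, rfl⟩ := List.mem_map.1 hl
    obtain ⟨t', -, h⟩ := List.mem_map.1 hl'
    exact hne (by injection h with h1; exact h1.symm)

/-- The word of a given shape whose string of indeterminates is the beginning of a given list. -/
def fill : FreeMagma Unit → List ℕ → FreeMagma ℕ
  | .of _, l => .of (l.headD 0)
  | .mul u v, l => .mul (fill u l) (fill v (l.drop (wordOrder u + 1)))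

theorem length_wordVars (w : FreeMagma ℕ) : (wordVars w).length = wordOrder w + 1 := by
  induction w using FreeMagma.rec with
  | of => rfl
  | mul u v hu hv =>
    simp only [wordVars, wordOrder, List.length_append, hu, hv]
    omega

/-- The arbitrary tail `l` carries the induction: for a left factor, the string of the right factor
is part of the tail. -/
theorem fill_wordShape_append (w : FreeMagma ℕ) : ∀ l : List ℕ,
    fill (wordShape w) (wordVars w ++ l) = w := by
  induction w using FreeMagma.rec with
  | of => intro l; rfl
  | mul u v hu hv =>
    intro l
    change FreeMagma.mul (fill (wordShape u) (wordVars u ++ wordVars v ++ l)) (fill (wordShape v)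
      ((wordVars u ++ wordVars v ++ l).drop (wordOrder (wordShape u) + 1))) = _
    rw [wordOrder_wordShape, List.append_assoc, List.drop_left' (length_wordVars u), hu, hv]

theorem fill_wordShape_wordVars (w : FreeMagma ℕ) : fill (wordShape w) (wordVars w) = w := by
  simpa using fill_wordShape_append w []

theorem wordShape_fill (s : FreeMagma Unit) : ∀ l : List ℕ, wordShape (fill s l) = s := by
  induction s using FreeMagma.rec with
  | of => intro l; rfl
  | mul u v hu hv => intro l; exact congrArg₂ FreeMagma.mul (hu _) (hv _)

theorem wordVars_fill (s : FreeMagma Unit) : ∀ l : List ℕ, wordOrder s + 1 ≤ l.length →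
    wordVars (fill s l) = l.take (wordOrder s + 1) := by
  induction s using FreeMagma.rec with
  | of =>
    intro l hl
    cases l with
    | nil => simp at hl
    | cons a l => rfl
  | mul u v hu hv =>
    intro l hl
    simp only [wordOrder] at hl ⊢
    rw [fill, wordVars, hu _ (by omega), hv _ (by rw [List.length_drop]; omega),
      ← List.take_add]
    congr 1
    omega

/-- The law with sides of given shapes and with a given string of indeterminates. -/
def ofShapes (s t : FreeMagma Unit) (l : List ℕ) : MagmaLaw :=
  ⟨fill s l, fill t (l.drop (wordOrder s + 1))⟩

theorem ofShapes_self (L : MagmaLaw) :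
    ofShapes (wordShape L.lhs) (wordShape L.rhs) L.vars = L := by
  rw [ofShapes, vars, wordOrder_wordShape, List.drop_left' (length_wordVars _),
    fill_wordShape_append, fill_wordShape_wordVars]

theorem vars_ofShapes {s t : FreeMagma Unit} {l : List ℕ}
    (h : l.length = wordOrder s + wordOrder t + 2) : (ofShapes s t l).vars = l := by
  rw [ofShapes, vars, wordVars_fill _ _ (by omega),
    wordVars_fill _ _ (by rw [List.length_drop]; omega), ← List.take_add,
    List.take_of_length_le (by omega)]

theorem order_eq (L : MagmaLaw) :
    L.order = wordOrder (wordShape L.lhs) + wordOrder (wordShape L.rhs) := by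
  rw [wordOrder_wordShape, wordOrder_wordShape, order]

theorem length_vars (L : MagmaLaw) : L.vars.length = L.order + 2 := by
  rw [vars, List.length_append, length_wordVars, length_wordVars, order]
  omega

/-- Lexicographic comparison of strings, as a Boolean. -/
def ltVars : List ℕ → List ℕ → Bool
  | [], [] => false
  | [], _ :: _ => true
  | _ :: _, [] => false
  | x :: l, y :: l' => bif x.blt y then true else bif x.beq y then ltVars l l' else false

theorem ltVars_iff (l : List ℕ) : ∀ l', ltVars l l' = true ↔ l < l' := by
  induction l with
  | nil => intro l'; cases l' <;> simp [ltVars]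
  | cons x l ih =>
    intro l'
    cases l' with
    | nil => simp [ltVars]
    | cons y l' =>
      rw [List.cons_lt_cons_iff, ← ih, ltVars]
      rcases lt_trichotomy x y with h | h | h
      · have : x.blt y = true := by rwa [Nat.blt_eq]
        simp [this, h]
      · subst h
        have : x.blt x = false := by rw [Bool.eq_false_iff, Ne, Nat.blt_eq]; exact lt_irrefl x
        simp [this]
      · have h1 : x.blt y = false := by rw [Bool.eq_false_iff, Ne, Nat.blt_eq]; omega
        have h2 : x.beq y = false := by rw [Bool.eq_false_iff, Ne, Nat.beq_eq]; omega
        simp [h1, h2, h.le, h.ne']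

/-- Equality of shapes, as a Boolean. -/
def eqShape : FreeMagma Unit → FreeMagma Unit → Bool
  | .of _, .of _ => true
  | .of _, .mul _ _ => false
  | .mul _ _, .of _ => false
  | .mul u v, .mul u' v' => bif eqShape u u' then eqShape v v' else false

theorem eqShape_iff (s : FreeMagma Unit) : ∀ t, eqShape s t = true ↔ s = t := by
  induction s using FreeMagma.rec with
  | of => intro t; cases t <;> simp [eqShape]
  | mul u v hu hv =>
    intro t
    cases t with
    | of => simp [eqShape]
    | mul u' v' =>
      rw [eqShape, Bool.cond_eq_ite]
      have hm : FreeMagma.mul u v = FreeMagma.mul u' v' ↔ u = u' ∧ v = v' :=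
        ⟨fun h => by injection h with h1 h2; exact ⟨h1, h2⟩, fun h => by rw [h.1, h.2]⟩
      rw [hm, ← hu, ← hv]
      split_ifs <;> simp_all

/-- The order of shapes, as a Boolean. -/
def ltShape : FreeMagma Unit → FreeMagma Unit → Bool
  | .of _, .of _ => false
  | .of _, .mul _ _ => true
  | .mul _ _, .of _ => false
  | .mul u v, .mul u' v' =>
      bif (wordOrder u + wordOrder v).blt (wordOrder u' + wordOrder v') then true
      else bif (wordOrder u + wordOrder v).beq (wordOrder u' + wordOrder v') then
        bif ltShape u u' then true else bif eqShape u u' then ltShape v v' else false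
      else false

theorem ltShape_iff (s : FreeMagma Unit) : ∀ t, ltShape s t = true ↔ ShapeLT s t := by
  induction s using FreeMagma.rec with
  | of => intro t; cases t <;> simp [ltShape, ShapeLT]
  | mul u v hu hv =>
    intro t
    cases t with
    | of => simp [ltShape, ShapeLT]
    | mul u' v' =>
      rw [ltShape, ShapeLT, ← hu, ← hv, ← eqShape_iff]
      simp only [Bool.cond_eq_ite, Nat.blt_eq, Nat.beq_eq]
      split_ifs <;> simp_all

/-- Of the laws with two sides of the same shape, those that are listed: the string of
indeterminates must be least under exchange of the sides, and the sides different. -/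
def symmCheck (s : FreeMagma Unit) (l : List ℕ) : Bool :=
  let a := l.take (wordOrder s + 1)
  let b := l.drop (wordOrder s + 1)
  bif ltVars (canon (b ++ a)) l then false
  else bif ltVars a b then true else bif ltVars b a then true else (wordOrder s).beq 0

/-- The strings of indeterminates of the listed laws with sides of given shapes. -/
def stringsOfShapes (s t : FreeMagma Unit) : List (List ℕ) :=
  bif eqShape s t then (canonStrings (wordOrder s + wordOrder t + 2) 0).filter (symmCheck s)
  else canonStrings (wordOrder s + wordOrder t + 2) 0

/-- The listed laws with sides of given shapes. -/
def lawsOfShapes (s t : FreeMagma Unit) : List MagmaLaw :=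
  (stringsOfShapes s t).map (ofShapes s t)

/-- The pairs of shapes of the sides of listed laws of order at most `n`. -/
def shapePairs (n : ℕ) : List (FreeMagma Unit × FreeMagma Unit) :=
  (shapes n).flatMap fun s =>
    ((shapes n).filter fun t =>
      bif (wordOrder s + wordOrder t).ble n then !ltShape t s else false).map fun t => (s, t)

/-- The listed laws of order at most `n`. -/
def lawList (n : ℕ) : List MagmaLaw :=
  (shapePairs n).flatMap fun p => lawsOfShapes p.1 p.2

/-! ### Correctness of the enumeration. -/

theorem mem_canonStrings_zero {n : ℕ} {l : List ℕ} :
    l ∈ canonStrings n 0 ↔ l.length = n ∧ canon l = l := by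
  rw [mem_canonStrings, List.range_zero, canon]

/-- The final alternative of the test is reached when the sides coincide. It keeps order `0` only,
where canonicity forces the single indeterminate to be `0`. -/
theorem symmCheck_iff {L : MagmaLaw} (hc : canon L.vars = L.vars)
    (hs : wordShape L.lhs = wordShape L.rhs) : symmCheck (wordShape L.lhs) L.vars = true ↔
      ¬ canon L.symm.vars < L.vars ∧ (L.lhs = L.rhs → L = ⟨.of 0, .of 0⟩) := by
  have h1 : L.vars.take (wordOrder (wordShape L.lhs) + 1) = wordVars L.lhs := by
    rw [vars, wordOrder_wordShape, List.take_left' (length_wordVars _)]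
  have h2 : L.vars.drop (wordOrder (wordShape L.lhs) + 1) = wordVars L.rhs := by
    rw [vars, wordOrder_wordShape, List.drop_left' (length_wordVars _)]
  have h3 : L.lhs = L.rhs ↔ wordVars L.lhs = wordVars L.rhs := by
    refine ⟨fun h => by rw [h], fun h => ?_⟩
    rw [← fill_wordShape_wordVars L.lhs, hs, h, fill_wordShape_wordVars]
  rw [symmCheck, h1, h2, h3]
  simp only [Bool.cond_eq_ite, ltVars_iff]
  change (if canon L.symm.vars < L.vars then _ else _) = true ↔ _
  split_ifs with h4 h5 h6
  · simp [h4]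
  · simp [h4, h5.ne]
  · simp [h4, h6.ne']
  · have h7 : wordVars L.lhs = wordVars L.rhs := le_antisymm (not_lt.1 h6) (not_lt.1 h5)
    simp only [h4, h7, not_false_eq_true, true_and, forall_const, Nat.beq_eq]
    constructor
    · intro h0
      obtain ⟨l, r⟩ := L
      cases l with
      | mul u v => exact absurd h0 (Nat.succ_ne_zero _)
      | of i =>
        cases r with
        | mul u v => exact absurd hs nofun
        | of j =>
          simp [vars, wordVars, canon, canonAux] at hc h7
          rw [← h7, ← hc.1]
    · intro h0
      rw [h0]
      rfl

theorem mem_lawsOfShapes_iff {s t : FreeMagma Unit} (h : ¬ ShapeLT t s) {L : MagmaLaw} :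
    L ∈ lawsOfShapes s t ↔ L.IsListed ∧ wordShape L.lhs = s ∧ wordShape L.rhs = t := by
  constructor
  · intro hL
    obtain ⟨l, hl, rfl⟩ := List.mem_map.1 hL
    have hs : wordShape (ofShapes s t l).lhs = s := wordShape_fill _ _
    have ht : wordShape (ofShapes s t l).rhs = t := wordShape_fill _ _
    refine ⟨?_, hs, ht⟩
    rw [stringsOfShapes] at hl
    have hl' : l ∈ canonStrings (wordOrder s + wordOrder t + 2) 0 := by
      revert hl
      cases eqShape s t
      · exact id
      · exact fun h => (List.mem_filter.1 h).1
    obtain ⟨hlen, hc⟩ := mem_canonStrings_zero.1 hl'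
    have hv := vars_ofShapes hlen
    rw [isListed_iff, hs, ht, hv]
    refine ⟨hc, h, ?_⟩
    by_cases he : s = t
    · rw [(eqShape_iff s t).2 he] at hl
      have hm := (List.mem_filter.1 hl).2
      have := (symmCheck_iff (L := ofShapes s t l) (by rw [hv, hc]) (by rw [hs, ht, he])).1
        (by rw [hs, hv]; exact hm)
      rw [hv] at this
      exact ⟨fun _ => this.1, this.2⟩
    · refine ⟨fun h => absurd h he, fun h => absurd ?_ he⟩
      exact hs.symm.trans ((congrArg wordShape h).trans ht)
  · rintro ⟨hL, rfl, rfl⟩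
    obtain ⟨hc, -, hv, hz⟩ := (isListed_iff L).1 hL
    refine List.mem_map.2 ⟨L.vars, ?_, ofShapes_self L⟩
    rw [stringsOfShapes]
    have hm : L.vars ∈ canonStrings (wordOrder (wordShape L.lhs) +
        wordOrder (wordShape L.rhs) + 2) 0 :=
      mem_canonStrings_zero.2 ⟨by rw [length_vars, order_eq], hc⟩
    by_cases he : wordShape L.lhs = wordShape L.rhs
    · rw [(eqShape_iff _ _).2 he]
      exact List.mem_filter.2 ⟨hm, (symmCheck_iff hc he).2 ⟨hv he, hz⟩⟩
    · rw [Bool.eq_false_iff.2 fun h => he ((eqShape_iff _ _).1 h)]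
      exact hm

theorem mem_shapePairs {n : ℕ} {s t : FreeMagma Unit} :
    (s, t) ∈ shapePairs n ↔ s ∈ shapes n ∧ t ∈ shapes n ∧ wordOrder s + wordOrder t ≤ n ∧
      ¬ ShapeLT t s := by
  have hb : (bif (wordOrder s + wordOrder t).ble n then !ltShape t s else false) = true ↔
      wordOrder s + wordOrder t ≤ n ∧ ¬ ShapeLT t s := by
    rw [Bool.cond_eq_ite, ← ltShape_iff, ← Nat.ble_eq]
    split_ifs <;> simp_all
  simp only [shapePairs, List.mem_flatMap, List.mem_map, List.mem_filter, Prod.mk.injEq]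
  constructor
  · rintro ⟨s', hs', t', ⟨ht', h⟩, rfl, rfl⟩
    exact ⟨hs', ht', hb.1 h⟩
  · rintro ⟨hs, ht, h⟩
    exact ⟨s, hs, t, ⟨ht, hb.2 h⟩, rfl, rfl⟩

theorem mem_lawList {n : ℕ} {L : MagmaLaw} : L ∈ lawList n ↔ L.IsListed ∧ L.order ≤ n := by
  rw [lawList, List.mem_flatMap]
  constructor
  · rintro ⟨⟨s, t⟩, hp, hL⟩
    obtain ⟨-, -, ho, hlt⟩ := mem_shapePairs.1 hp
    obtain ⟨h, rfl, rfl⟩ := (mem_lawsOfShapes_iff hlt).1 hL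
    exact ⟨h, by rwa [order_eq]⟩
  · rintro ⟨hL, ho⟩
    rw [order_eq] at ho
    have hlt := ((isListed_iff L).1 hL).2.1
    exact ⟨(wordShape L.lhs, wordShape L.rhs), mem_shapePairs.2
      ⟨mem_shapes (by omega), mem_shapes (by omega), ho, hlt⟩,
      (mem_lawsOfShapes_iff hlt).2 ⟨hL, rfl, rfl⟩⟩

theorem nodup_shapePairs (n : ℕ) : (shapePairs n).Nodup := by
  refine List.nodup_flatMap.2 ⟨fun s _ => ?_, ?_⟩
  · exact ((nodup_shapes n).filter _).map fun t t' h => (Prod.mk.inj h).2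
  · refine (nodup_shapes n).imp fun {s s'} hne p hp hp' => ?_
    obtain ⟨t, -, rfl⟩ := List.mem_map.1 hp
    obtain ⟨t', -, h⟩ := List.mem_map.1 hp'
    exact hne (Prod.mk.inj h).1.symm

theorem nodup_lawsOfShapes (s t : FreeMagma Unit) : (lawsOfShapes s t).Nodup := by
  have key : ∀ m : List (List ℕ), m.Nodup →
      (∀ l ∈ m, l ∈ canonStrings (wordOrder s + wordOrder t + 2) 0) →
      (m.map (ofShapes s t)).Nodup := by
    intro m hm hmem
    refine hm.map_on fun l hl l' hl' h => ?_
    have e1 := vars_ofShapes (mem_canonStrings_zero.1 (hmem l hl)).1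
    have e2 := vars_ofShapes (mem_canonStrings_zero.1 (hmem l' hl')).1
    rw [← e1, ← e2, h]
  apply key
  all_goals rw [stringsOfShapes]
  · cases eqShape s t
    · exact nodup_canonStrings _ _
    · exact (nodup_canonStrings _ _).filter _
  · cases eqShape s t
    · exact fun _ => id
    · exact fun l hl => (List.mem_filter.1 hl).1

theorem nodup_lawList (n : ℕ) : (lawList n).Nodup := by
  refine List.nodup_flatMap.2 ⟨fun p _ => nodup_lawsOfShapes _ _, ?_⟩
  refine (nodup_shapePairs n).imp fun {p p'} hne L hL hL' => hne ?_
  obtain ⟨l, -, rfl⟩ := List.mem_map.1 hL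
  obtain ⟨l', -, h⟩ := List.mem_map.1 hL'
  have h1 := congrArg (fun L => wordShape L.lhs) h
  have h2 := congrArg (fun L => wordShape L.rhs) h
  simp only [ofShapes, wordShape_fill] at h1 h2
  exact Prod.ext h1.symm h2.symm

theorem lawsUpToFour_eq : lawsUpToFour = {L | L ∈ lawList 4} := by
  ext L
  exact mem_lawList.symm

/-- The number of listed laws of order at most `4` with a property that a Boolean test decides. -/
theorem ncard_sep_lawsUpToFour (p : MagmaLaw → Prop) (b : MagmaLaw → Bool)
    (h : ∀ L ∈ lawList 4, p L ↔ b L = true) :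
    {L ∈ lawsUpToFour | p L}.ncard = (lawList 4).countP b := by
  classical
  have : {L ∈ lawsUpToFour | p L} = (((lawList 4).filter b).toFinset : Set MagmaLaw) := by
    ext L
    rw [lawsUpToFour_eq]
    simp only [Set.mem_ofPred_eq, List.coe_toFinset, List.mem_filter]
    exact and_congr_right fun hL => h L hL
  rw [this, Set.ncard_coe_finset, List.toFinset_card_of_nodup ((nodup_lawList 4).filter _),
    List.countP_eq_length_filter]

/-! ### Summation over the list of laws -/

/-- Apply `k` to the word of shape `s` with the indeterminates at the beginning of the list `l`,
and to the rest of the list. In this form, and with recursors in place of pattern matching, the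
kernel evaluates the word only once. -/
noncomputable def fillThen {R : Type} (s : FreeMagma Unit) :
    List ℕ → (FreeMagma ℕ → List ℕ → R) → R :=
  FreeMagma.rec (fun _ l k => List.rec (k (.of 0) []) (fun x l _ => k (.of x) l) l)
    (fun _ _ f g l k => f l fun a l => g l fun b l => k (.mul a b) l) s

theorem fillThen_eq {R : Type} (s : FreeMagma Unit) : ∀ (l : List ℕ)
    (k : FreeMagma ℕ → List ℕ → R), fillThen s l k = k (fill s l) (l.drop (wordOrder s + 1)) := by
  induction s using FreeMagma.rec with
  | of => intro l k; cases l <;> rfl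
  | mul u v hu hv =>
    intro l k
    change fillThen u l (fun a l => fillThen v l fun b l => k (.mul a b) l) = _
    rw [hu, hv, List.drop_drop, fill, wordOrder]
    congr 2
    omega

/-- The sum of a function of the two sides over the listed laws of order at most `n`. -/
noncomputable def lawSum (n : ℕ) (w : FreeMagma ℕ → FreeMagma ℕ → ℕ) : ℕ :=
  ((shapePairs n).map fun p => ((stringsOfShapes p.1 p.2).map fun l =>
    fillThen p.1 l fun a l => fillThen p.2 l fun b _ => w a b).sum).sum

theorem lawSum_eq (n : ℕ) (w : FreeMagma ℕ → FreeMagma ℕ → ℕ) :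
    lawSum n w = ((lawList n).map fun L => w L.lhs L.rhs).sum := by
  rw [lawSum, lawList, List.map_flatMap, List.flatMap_def, List.sum_flatten, List.map_map]
  congr 2
  ext p
  simp only [Function.comp, lawsOfShapes, List.map_map, fillThen_eq]
  rfl

/-- An upper bound for the indeterminates of a word. -/
noncomputable def bound (w : FreeMagma ℕ) : ℕ :=
  FreeMagma.rec (fun i => Nat.succ i) (fun _ _ p q => Bool.rec p q (Nat.ble p q)) w

theorem bound_mul (u v : FreeMagma ℕ) : bound (.mul u v) = max (bound u) (bound v) := by
  change Bool.rec (motive := fun _ => ℕ) (bound u) (bound v)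
    (Nat.ble (bound u) (bound v)) = _
  cases h : Nat.ble (bound u) (bound v)
  · rw [← Bool.not_eq_true, Nat.ble_eq] at h
    simp only
    omega
  · rw [Nat.ble_eq] at h
    simp only
    omega

/-- This allows an identity to be tested on finitely many finite assignments. -/
theorem wordValue_congr {M : Type} (op : M → M → M) {f g : ℕ → M} (w : FreeMagma ℕ)
    (h : ∀ i < bound w, f i = g i) : wordValue op f w = wordValue op g w := by
  induction w using FreeMagma.rec with
  | of i => exact h i (Nat.lt_succ_self i)
  | mul u v hu hv =>
    rw [bound_mul] at h
    rw [wordValue, wordValue, hu fun i hi => h i (by omega), hv fun i hi => h i (by omega)]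

/-! ### Linear models -/

/-- The product of signs. -/
def signMul : SignType → SignType → SignType
  | .zero, _ => .zero
  | .pos, s => s
  | .neg, .zero => .zero
  | .neg, .pos => .neg
  | .neg, .neg => .pos

theorem intCast_signMul (a s : SignType) : ((signMul a s : SignType) : ℤ) = a * s := by
  cases a <;> cases s <;> rfl

/-- The word `w`, multiplied by the sign `s`, is a linear combination of its indeterminates under
the operation `a x + b y`. The `i`-th digit in base `16` of the result is the coefficient of the
`i`-th indeterminate, increased by the number of its occurrences. -/
noncomputable def linearCode (a b : SignType) (w : FreeMagma ℕ) : SignType → ℕ :=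
  FreeMagma.rec (fun i s => SignType.rec (Nat.pow 16 i) 0 (Nat.mul 2 (Nat.pow 16 i)) s)
    (fun _ _ p q s => Nat.add (p (signMul a s)) (q (signMul b s))) w

/-- The numbers of occurrences of the indeterminates of a word, as digits in base `16`. -/
noncomputable def occurrenceCode (w : FreeMagma ℕ) : ℕ :=
  FreeMagma.rec (fun i => Nat.pow 16 i) (fun _ _ p q => Nat.add p q) w

/-- Do the two sides agree under the operation `a x + b y`? -/
noncomputable def linearCheck (u v : FreeMagma ℕ) (a b : SignType) : Bool :=
  Nat.beq (Nat.add (linearCode a b u .pos) (occurrenceCode v))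
    (Nat.add (linearCode a b v .pos) (occurrenceCode u))

/-- Do the two sides agree under one of the nine linear operations? -/
noncomputable def isLinear (u v : FreeMagma ℕ) : Bool :=
  (((linearCheck u v .pos .zero || linearCheck u v .zero .pos) ||
    (linearCheck u v .zero .zero || linearCheck u v .pos .pos)) ||
    ((linearCheck u v .pos .neg || linearCheck u v .neg .pos) ||
    (linearCheck u v .neg .neg || linearCheck u v .zero .neg))) || linearCheck u v .neg .zero

/-- The digits of `linearCode`. -/
def linearDigit (a b : SignType) : FreeMagma ℕ → SignType → ℕ → ℕ
  | .of i, s, j => if j = i then (1 + (s : ℤ)).toNat else 0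
  | .mul u v, s, j => linearDigit a b u (signMul a s) j + linearDigit a b v (signMul b s) j

theorem linearCode_eq (a b : SignType) {k : ℕ} (w : FreeMagma ℕ) : ∀ s : SignType, bound w ≤ k →
    linearCode a b w s = ∑ j ∈ Finset.range k, linearDigit a b w s j * 16 ^ j := by
  induction w using FreeMagma.rec with
  | of i =>
    intro s hi
    simp only [linearDigit, ite_mul, zero_mul]
    rw [Finset.sum_ite_eq' (Finset.range k) i, if_pos (Finset.mem_range.2 hi)]
    change SignType.rec (motive := fun _ => ℕ) (16 ^ i) 0 (2 * 16 ^ i) s = _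
    cases s <;> simp
  | mul u v hu hv =>
    intro s hw
    rw [bound_mul] at hw
    change linearCode a b u _ + linearCode a b v _ = _
    rw [hu _ (by omega), hv _ (by omega), ← Finset.sum_add_distrib]
    exact Finset.sum_congr rfl fun j _ => by rw [linearDigit, add_mul]

theorem occurrenceCode_eq {k : ℕ} (w : FreeMagma ℕ) (hw : bound w ≤ k) :
    occurrenceCode w = ∑ j ∈ Finset.range k, (wordVars w).count j * 16 ^ j := by
  induction w using FreeMagma.rec with
  | of i =>
    have h : ∀ j ∈ Finset.range k, (wordVars (.of i)).count j * 16 ^ j =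
        if j = i then 16 ^ j else 0 := by
      intro j _
      simp only [wordVars, List.count_singleton, beq_iff_eq, eq_comm (a := i)]
      split_ifs <;> simp
    rw [Finset.sum_congr rfl h, Finset.sum_ite_eq' (Finset.range k) i,
      if_pos (Finset.mem_range.2 hw)]
    rfl
  | mul u v hu hv =>
    rw [bound_mul] at hw
    change occurrenceCode u + occurrenceCode v = _
    rw [hu (by omega), hv (by omega), ← Finset.sum_add_distrib]
    exact Finset.sum_congr rfl fun j _ => by rw [wordVars, List.count_append, add_mul]

theorem linearDigit_le (a b : SignType) (j : ℕ) (w : FreeMagma ℕ) : ∀ s : SignType,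
    linearDigit a b w s j ≤ 2 * (wordVars w).count j := by
  induction w using FreeMagma.rec with
  | of i =>
    intro s
    simp only [linearDigit, wordVars, List.count_singleton, beq_iff_eq, eq_comm (a := i)]
    cases s <;> split_ifs <;> simp
  | mul u v hu hv =>
    intro s
    have h1 := hu (signMul a s)
    have h2 := hv (signMul b s)
    rw [linearDigit, wordVars, List.count_append]
    omega

/-- The sign `s` is the coefficient that a surrounding word puts on `w`. It is multiplied by `a` or
`b` on passing to a factor, so the induction needs all signs at once. -/
theorem mul_wordValue_linear {R : Type} [CommRing R] (a b : SignType) {k : ℕ} (f : ℕ → R)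
    (w : FreeMagma ℕ) : ∀ s : SignType, bound w ≤ k →
    ((s : ℤ) : R) * wordValue (fun x y => ((a : ℤ) : R) * x + ((b : ℤ) : R) * y) f w =
      ∑ j ∈ Finset.range k, ((linearDigit a b w s j : R) - ((wordVars w).count j : R)) * f j := by
  induction w using FreeMagma.rec with
  | of i =>
    intro s hi
    have h : ∀ j ∈ Finset.range k,
        ((linearDigit a b (.of i) s j : R) - ((wordVars (.of i)).count j : R)) * f j =
        if j = i then ((s : ℤ) : R) * f j else 0 := by
      intro j _
      simp only [linearDigit, wordVars, List.count_singleton, beq_iff_eq, eq_comm (a := i)]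
      split_ifs
      · cases s <;> norm_num [show Int.toNat 2 = 2 from rfl]
      · simp
    rw [Finset.sum_congr rfl h, Finset.sum_ite_eq' (Finset.range k) i,
      if_pos (Finset.mem_range.2 hi)]
    rfl
  | mul u v hu hv =>
    intro s hw
    rw [bound_mul] at hw
    have h1 := hu (signMul a s) (by omega)
    have h2 := hv (signMul b s) (by omega)
    rw [intCast_signMul, Int.cast_mul] at h1 h2
    have h3 : ∀ j ∈ Finset.range k, ((linearDigit a b (.mul u v) s j : R) -
        ((wordVars (.mul u v)).count j : R)) * f j =
        ((linearDigit a b u (signMul a s) j : R) - ((wordVars u).count j : R)) * f j +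
        ((linearDigit a b v (signMul b s) j : R) - ((wordVars v).count j : R)) * f j := by
      intro j _
      rw [linearDigit, wordVars, List.count_append]
      push_cast
      ring
    rw [Finset.sum_congr rfl h3, Finset.sum_add_distrib, ← h1, ← h2, wordValue]
    ring

theorem digits_eq_of_sum_eq {k : ℕ} : ∀ {x y : ℕ → ℕ}, (∀ j, x j < 16) → (∀ j, y j < 16) →
    ∑ j ∈ Finset.range k, x j * 16 ^ j = ∑ j ∈ Finset.range k, y j * 16 ^ j →
    ∀ j < k, x j = y j := by
  induction k with
  | zero => intro x y _ _ _ j hj; omega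
  | succ k ih =>
    intro x y hx hy h
    -- Splits off the lowest digit, so that the equation can be read modulo 16.
    have e : ∀ z : ℕ → ℕ, ∑ j ∈ Finset.range (k + 1), z j * 16 ^ j =
        16 * ∑ j ∈ Finset.range k, z (j + 1) * 16 ^ j + z 0 := by
      intro z
      rw [Finset.sum_range_succ', Finset.mul_sum, pow_zero, mul_one]
      congr 1
      exact Finset.sum_congr rfl fun j _ => by ring
    rw [e, e] at h
    have h1 := hx 0
    have h2 := hy 0
    intro j hj
    cases j with
    | zero => omega
    | succ j =>
      exact ih (x := fun j => x (j + 1)) (y := fun j => y (j + 1)) (fun j => hx _)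
        (fun j => hy _) (by omega) j (by omega)

/-- Adding the occurrences on the other side balances the shifts in the two codes, so equal digits
mean equal integer coefficients, and these give the identity in any commutative ring. -/
theorem satisfiedBy_of_linearCheck {L : MagmaLaw} (ho : L.order ≤ 4) {a b : SignType}
    (h : linearCheck L.lhs L.rhs a b = true) {R : Type} [CommRing R] :
    L.SatisfiedBy (fun x y : R => ((a : ℤ) : R) * x + ((b : ℤ) : R) * y) := by
  intro f
  have hl : bound L.lhs ≤ max (bound L.lhs) (bound L.rhs) := le_max_left _ _
  have hr : bound L.rhs ≤ max (bound L.lhs) (bound L.rhs) := le_max_right _ _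
  have h1 := Nat.eq_of_beq_eq_true h
  change linearCode a b L.lhs .pos + occurrenceCode L.rhs =
    linearCode a b L.rhs .pos + occurrenceCode L.lhs at h1
  rw [linearCode_eq a b _ _ hl, linearCode_eq a b _ _ hr, occurrenceCode_eq _ hl,
    occurrenceCode_eq _ hr, ← Finset.sum_add_distrib, ← Finset.sum_add_distrib] at h1
  simp only [← add_mul] at h1
  -- A law of order at most 4 has at most six occurrences, each adding at most 2 to a digit. Hence
  -- digits are at most 12 and base 16 has no carries.
  have hc : ∀ j, (wordVars L.lhs).count j + (wordVars L.rhs).count j ≤ 6 := by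
    intro j
    rw [← List.count_append]
    refine List.count_le_length.trans ?_
    have := length_vars L
    rw [vars] at this
    omega
  have hd := digits_eq_of_sum_eq (fun j => ?_) (fun j => ?_) h1
  · have e1 := mul_wordValue_linear a b f L.lhs .pos hl
    have e2 := mul_wordValue_linear a b f L.rhs .pos hr
    simp only [SignType.pos_eq_one, SignType.coe_one, Int.cast_one, one_mul] at e1 e2
    rw [e1, e2]
    refine Finset.sum_congr rfl fun j hj => ?_
    have := congrArg (Nat.cast (R := R)) (hd j (Finset.mem_range.1 hj))
    push_cast at this
    congr 1
    simp only [SignType.pos_eq_one] at this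
    linear_combination this
  · have := linearDigit_le a b j L.lhs .pos
    have := hc j
    omega
  · have := linearDigit_le a b j L.rhs .pos
    have := hc j
    omega

theorem hasLinearModels_of_isLinear {L : MagmaLaw} (ho : L.order ≤ 4)
    (h : isLinear L.lhs L.rhs = true) : L.HasLinearModels := by
  have key : ∀ a b : SignType, linearCheck L.lhs L.rhs a b = true → L.HasLinearModels := by
    intro a b hab
    have hs : ∀ s : SignType, (s : ℤ) ∈ ({-1, 0, 1} : Set ℤ) := by
      intro s
      cases s <;> simp
    exact ⟨a, hs a, b, hs b, fun n _ => satisfiedBy_of_linearCheck ho hab⟩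
  simp only [isLinear, Bool.or_eq_true] at h
  rcases h with (((h | h) | h | h) | (h | h) | h | h) | h <;> exact key _ _ h

/-! ### Search for models of a given size -/

/-- The outcome of the evaluation of a word in a partial operation table: a value, or the
arguments of a product that the table does not have. -/
inductive Outcome
  | value (v : ℕ)
  | missing (a b : ℕ)

/-- The product of `a` and `b` in a table, which is a list of triples `(a, b, a * b)`. -/
noncomputable def lookup (a b : ℕ) (T : List (ℕ × ℕ × ℕ)) : Outcome :=
  List.rec (.missing a b) (fun e _ r =>
    Bool.rec r (Bool.rec r (.value e.2.2) (Nat.beq b e.2.1)) (Nat.beq a e.1)) T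

/-- The entry of a list at a given position, or `0`. -/
noncomputable def entry (l : List ℕ) : ℕ → ℕ :=
  List.rec (fun _ => 0) (fun x _ r i => Nat.rec x (fun j _ => r j) i) l

/-- The value of a word in the table `T` under the assignment `f`. -/
noncomputable def evalTable (T : List (ℕ × ℕ × ℕ)) (f : List ℕ) (w : FreeMagma ℕ) : Outcome :=
  FreeMagma.rec (fun i => .value (entry f i))
    (fun _ _ p q => Outcome.rec (fun a => Outcome.rec (fun b => lookup a b T) .missing q)
      .missing p) w

/-- Does `p` hold throughout the list? -/
noncomputable def allRec {α : Type} (p : α → Bool) (l : List α) : Bool :=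
  List.rec true (fun x _ r => Bool.rec false r (p x)) l

/-- Search for an operation with the given values that extends the table `T` and satisfies the law
`u ≃ v` under the given assignments, in at most `n` steps; the answer `true` means that there is
none. -/
noncomputable def refute (vals : List ℕ) (u v : FreeMagma ℕ) (n : ℕ) :
    List (ℕ × ℕ × ℕ) → List (List ℕ) → Bool :=
  Nat.rec (fun _ _ => false) (fun _ r T F => List.rec false (fun f F' _ =>
    Outcome.rec
      (fun x => Outcome.rec (fun y => Bool.rec true (r T F') (Nat.beq x y))
        (fun a b => allRec (fun c => r ((a, b, c) :: T) F) vals) (evalTable T f v))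
      (fun a b => allRec (fun c => r ((a, b, c) :: T) F) vals) (evalTable T f u)) F) n

/-- The lists of length `n` with entries in a given list. -/
def assignments (vals : List ℕ) : ℕ → List (List ℕ)
  | 0 => [[]]
  | n + 1 => (assignments vals n).flatMap fun l => vals.map fun v => v :: l

/-- The number of indeterminates to be considered for the law `u ≃ v`. -/
noncomputable def bound₂ (u v : FreeMagma ℕ) : ℕ :=
  Bool.rec (bound u) (bound v) (Nat.ble (bound u) (bound v))

/-- Does the search show that the law `u ≃ v` has no model with the given values? -/
noncomputable def noModel (vals : List ℕ) (u v : FreeMagma ℕ) : Bool :=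
  refute vals u v 100 [] (assignments vals (bound₂ u v))

/-- Do `u` and `v` have the same value in the table `T` under all assignments? -/
noncomputable def isModel (vals : List ℕ) (T : List (ℕ × ℕ × ℕ)) (u v : FreeMagma ℕ) : Bool :=
  allRec (fun f => Outcome.rec (fun x => Outcome.rec (fun y => Nat.beq x y) (fun _ _ => false)
    (evalTable T f v)) (fun _ _ => false) (evalTable T f u)) (assignments vals (bound₂ u v))

theorem bound₂_eq (u v : FreeMagma ℕ) : bound₂ u v = max (bound u) (bound v) :=
  bound_mul u v

theorem allRec_iff {α : Type} {p : α → Bool} {l : List α} :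
    allRec p l = true ↔ ∀ x ∈ l, p x = true := by
  induction l with
  | nil => simp [allRec]
  | cons x l ih =>
    change Bool.rec (motive := fun _ => Bool) false (allRec p l) (p x) = true ↔ _
    rw [List.forall_mem_cons, ← ih]
    cases p x <;> simp

theorem mem_assignments {vals : List ℕ} {n : ℕ} : ∀ {l : List ℕ},
    l ∈ assignments vals n ↔ l.length = n ∧ ∀ x ∈ l, x ∈ vals := by
  induction n with
  | zero =>
    intro l
    simp only [assignments, List.mem_singleton, List.length_eq_zero_iff]
    exact ⟨fun h => ⟨h, by simp [h]⟩, fun h => h.1⟩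
  | succ n ih =>
    intro l
    cases l with
    | nil => simp [assignments]
    | cons x t =>
      have key : x :: t ∈ assignments vals (n + 1) ↔ x ∈ vals ∧ t ∈ assignments vals n := by
        simp only [assignments, List.mem_flatMap, List.mem_map, List.cons.injEq]
        exact ⟨fun ⟨a, ha, v, hv, h1, h2⟩ => ⟨h1 ▸ hv, h2 ▸ ha⟩,
          fun ⟨hx, ht⟩ => ⟨t, ht, x, hx, rfl, rfl⟩⟩
      rw [key, ih, List.forall_mem_cons, List.length_cons, Nat.add_right_cancel_iff]
      tauto

theorem entry_mem {vals l : List ℕ} (h0 : 0 ∈ vals) (h : ∀ x ∈ l, x ∈ vals) :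
    ∀ i, entry l i ∈ vals := by
  induction l with
  | nil => exact fun _ => h0
  | cons x l ih =>
    rw [List.forall_mem_cons] at h
    intro i
    cases i with
    | zero => exact h.1
    | succ i => exact ih h.2 i

theorem entry_map_range {n : ℕ} : ∀ (f : ℕ → ℕ) {i : ℕ}, i < n →
    entry ((List.range n).map f) i = f i := by
  induction n with
  | zero => intro f i hi; omega
  | succ n ih =>
    intro f i hi
    rw [List.range_succ_eq_map, List.map_cons, List.map_map]
    cases i with
    | zero => rfl
    | succ i => exact ih (f ∘ Nat.succ) (by omega)

/-! ### Soundness of evaluation and search in partial tables. -/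

section

variable {M : Type} {op : M → M → M} {e : ℕ → M} {vals : List ℕ}

/-- The entries of the table `T` are products in the magma `(M, op)`, where `e` numbers the
elements of `M`. -/
def Agrees (op : M → M → M) (e : ℕ → M) (vals : List ℕ) (T : List (ℕ × ℕ × ℕ)) : Prop :=
  ∀ t ∈ T, t.2.2 ∈ vals ∧ op (e t.1) (e t.2.1) = e t.2.2

theorem lookup_sound {T : List (ℕ × ℕ × ℕ)} (hT : Agrees op e vals T) {a b x : ℕ}
    (h : lookup a b T = .value x) : x ∈ vals ∧ op (e a) (e b) = e x := by
  induction T with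
  | nil => exact Outcome.noConfusion h
  | cons t T ih =>
    obtain ⟨a', b', c⟩ := t
    have ih := ih fun t ht => hT t (List.mem_cons_of_mem _ ht)
    have hc := hT _ List.mem_cons_self
    change Bool.rec (motive := fun _ => Outcome) (lookup a b T)
      (Bool.rec (motive := fun _ => Outcome) (lookup a b T) (.value c) (Nat.beq b b'))
      (Nat.beq a a') = _ at h
    cases ha : Nat.beq a a'
    · rw [ha] at h
      exact ih h
    · cases hb : Nat.beq b b'
      · rw [ha, hb] at h
        exact ih h
      · rw [ha, hb] at h
        obtain rfl : c = x := Outcome.value.inj h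
        rw [Nat.eq_of_beq_eq_true ha, Nat.eq_of_beq_eq_true hb]
        exact hc

theorem evalTable_sound {T : List (ℕ × ℕ × ℕ)} (hT : Agrees op e vals T) {f : List ℕ}
    (hf : ∀ i, entry f i ∈ vals) (w : FreeMagma ℕ) : ∀ {x : ℕ}, evalTable T f w = .value x →
    x ∈ vals ∧ wordValue op (fun i => e (entry f i)) w = e x := by
  induction w using FreeMagma.rec with
  | of i =>
    intro x h
    obtain rfl : entry f i = x := Outcome.value.inj h
    exact ⟨hf i, rfl⟩
  | mul u v hu hv =>
    intro x h
    change Outcome.rec (motive := fun _ => Outcome) (fun a => Outcome.rec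
      (motive := fun _ => Outcome) (fun b => lookup a b T) .missing (evalTable T f v)) .missing
      (evalTable T f u) = _ at h
    cases hu' : evalTable T f u with
    | missing a b =>
      rw [hu'] at h
      exact Outcome.noConfusion h
    | value a =>
      cases hv' : evalTable T f v with
      | missing a b =>
        rw [hu', hv'] at h
        exact Outcome.noConfusion h
      | value b =>
        rw [hu', hv'] at h
        have := lookup_sound hT h
        rw [wordValue, (hu hu').2, (hv hv').2]
        exact this

/-- Follow the branch of the search that agrees with the given model: it never meets a
contradiction. Running out of steps answers `false`, so the bound on the steps cannot cause a false
refutation. -/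
theorem refute_sound (he : ∀ m, ∃ v ∈ vals, e v = m)
    (hi : ∀ x ∈ vals, ∀ y ∈ vals, e x = e y → x = y) {L : MagmaLaw} (hL : L.SatisfiedBy op)
    (n : ℕ) : ∀ (T : List (ℕ × ℕ × ℕ)) (F : List (List ℕ)), Agrees op e vals T →
    (∀ f ∈ F, ∀ i, entry f i ∈ vals) → refute vals L.lhs L.rhs n T F = false := by
  induction n with
  | zero => intro T F _ _; rfl
  | succ n ih =>
    intro T F hT hF
    cases F with
    | nil => rfl
    | cons f F =>
      -- If a product is missing, the branch in which it gets its true value is not refuted.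
      have hb : ∀ a b, allRec (fun c => refute vals L.lhs L.rhs n ((a, b, c) :: T) (f :: F)) vals
          = false := by
        intro a b
        obtain ⟨c, hc, h⟩ := he (op (e a) (e b))
        refine Bool.eq_false_iff.2 fun hall => ?_
        have := allRec_iff.1 hall c hc
        rw [ih ((a, b, c) :: T) (f :: F) (List.forall_mem_cons.2 ⟨⟨hc, h.symm⟩, hT⟩) hF] at this
        exact Bool.noConfusion this
      have hF' := List.forall_mem_cons.1 hF
      change Outcome.rec (motive := fun _ => Bool)
        (fun x => Outcome.rec (motive := fun _ => Bool)
          (fun y => Bool.rec true (refute vals L.lhs L.rhs n T F) (Nat.beq x y))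
          (fun a b => allRec (fun c => refute vals L.lhs L.rhs n ((a, b, c) :: T) (f :: F)) vals)
          (evalTable T f L.rhs))
        (fun a b => allRec (fun c => refute vals L.lhs L.rhs n ((a, b, c) :: T) (f :: F)) vals)
        (evalTable T f L.lhs) = false
      cases hu : evalTable T f L.lhs with
      | missing a b => exact hb a b
      | value x =>
        cases hv : evalTable T f L.rhs with
        | missing a b => exact hb a b
        | value y =>
          obtain ⟨hx, h1⟩ := evalTable_sound hT hF'.1 _ hu
          obtain ⟨hy, h2⟩ := evalTable_sound hT hF'.1 _ hv
          -- Both sides name the same element of the model, and `e` is injective on `vals`, so the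
          -- comparison succeeds.
          obtain rfl : x = y := hi x hx y hy (by rw [← h1, ← h2]; exact hL _)
          change Bool.rec (motive := fun _ => Bool) true _ (Nat.beq x x) = false
          rw [Nat.beq_refl]
          exact ih T F hT hF'.2

theorem satisfiedBy_of_isModel {T : List (ℕ × ℕ × ℕ)} (hT : Agrees op e vals T)
    (h0 : 0 ∈ vals) (he : ∀ m, ∃ v ∈ vals, e v = m) {L : MagmaLaw}
    (h : isModel vals T L.lhs L.rhs = true) : L.SatisfiedBy op := by
  intro g
  choose c hc hg using fun i => he (g i)
  have hv : ∀ x ∈ (List.range (bound₂ L.lhs L.rhs)).map c, x ∈ vals := by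
    intro x hx
    obtain ⟨i, -, rfl⟩ := List.mem_map.1 hx
    exact hc i
  have key := allRec_iff.1 h _ (mem_assignments.2 ⟨by simp, hv⟩)
  have hcongr : ∀ w, bound w ≤ bound₂ L.lhs L.rhs → wordValue op g w = wordValue op
      (fun i => e (entry ((List.range (bound₂ L.lhs L.rhs)).map c) i)) w := by
    intro w hw
    refine wordValue_congr op w fun i hi => ?_
    rw [entry_map_range c (hi.trans_le hw), hg]
  rw [hcongr _ (by rw [bound₂_eq]; exact le_max_left _ _),
    hcongr _ (by rw [bound₂_eq]; exact le_max_right _ _)]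
  -- Beyond the end of the list `entry` returns `0`, which is why `0` must be among the values.
  have hf := entry_mem h0 hv
  cases hu : evalTable T ((List.range (bound₂ L.lhs L.rhs)).map c) L.lhs with
  | missing a b =>
    rw [hu] at key
    exact Bool.noConfusion key
  | value x =>
    cases hu' : evalTable T ((List.range (bound₂ L.lhs L.rhs)).map c) L.rhs with
    | missing a b =>
      rw [hu, hu'] at key
      exact Bool.noConfusion key
    | value y =>
      rw [hu, hu'] at key
      rw [(evalTable_sound hT hf _ hu).2, (evalTable_sound hT hf _ hu').2,
        Nat.eq_of_beq_eq_true key]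

end

theorem notMem_spectrum_of_noModel {n : ℕ} {L : MagmaLaw}
    (h : noModel (List.range n) L.lhs L.rhs = true) : n ∉ L.spectrum := by
  rintro ⟨hn, M, hM, op, hc, hL⟩
  obtain ⟨φ⟩ : Nonempty (M ≃ Fin n) := ⟨hc ▸ Finite.equivFin M⟩
  -- Reduction modulo `n` only makes the numbering total; it is injective on `List.range n`.
  let e : ℕ → M := fun v => φ.symm ⟨v % n, Nat.mod_lt _ hn⟩
  have he : ∀ m, ∃ v ∈ List.range n, e v = m := fun m =>
    ⟨φ m, List.mem_range.2 (φ m).2, by simp [e, Nat.mod_eq_of_lt (φ m).2]⟩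
  have hi : ∀ x ∈ List.range n, ∀ y ∈ List.range n, e x = e y → x = y := by
    intro x hx y hy hxy
    have := congrArg Fin.val (φ.symm.injective hxy)
    simpa [Nat.mod_eq_of_lt (List.mem_range.1 hx), Nat.mod_eq_of_lt (List.mem_range.1 hy)]
      using this
  have := refute_sound he hi hL 100 [] (assignments (List.range n) (bound₂ L.lhs L.rhs))
    (by simp [Agrees])
    (fun f hf => entry_mem (List.mem_range.2 hn) (mem_assignments.1 hf).2)
  rw [noModel, this] at h
  exact Bool.noConfusion h

/-- The table of addition modulo `2`. -/
def xorTable : List (ℕ × ℕ × ℕ) := [(0, 0, 0), (0, 1, 1), (1, 0, 1), (1, 1, 0)]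

/-- The table of the operation that is `1` only for the arguments `0` and `0`. -/
def norTable : List (ℕ × ℕ × ℕ) := [(0, 0, 1), (0, 1, 0), (1, 0, 0), (1, 1, 0)]

/-- These two tables suffice for every law of size 2 but not of size 3 in the list: otherwise some
law would have kind `4`. -/
theorem two_mem_spectrum {L : MagmaLaw} (h : isModel [0, 1] xorTable L.lhs L.rhs = true ∨
    isModel [0, 1] norTable L.lhs L.rhs = true) : 2 ∈ L.spectrum := by
  have he : ∀ m : Bool, ∃ v ∈ [0, 1], (fun v => Nat.beq v 1) v = m := by decide
  rcases h with h | h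
  · refine ⟨two_pos, Bool, inferInstance, Bool.xor, by simp, satisfiedBy_of_isModel
      (e := fun v => Nat.beq v 1) ?_ (by simp) he h⟩
    simp [Agrees, xorTable, Nat.beq]
  · refine ⟨two_pos, Bool, inferInstance, fun x y => !(x || y), by simp, satisfiedBy_of_isModel
      (e := fun v => Nat.beq v 1) ?_ (by simp) he h⟩
    simp [Agrees, norTable, Nat.beq]

/-! ### Transfer to equivalent and dual laws -/

theorem wordValue_map {M : Type} (op : M → M → M) (f : ℕ → M) (σ : ℕ → ℕ) (w : FreeMagma ℕ) :
    wordValue op f (FreeMagma.map σ w) = wordValue op (f ∘ σ) w := by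
  induction w using FreeMagma.rec with
  | of => rfl
  | mul u v hu hv => exact congrArg₂ op hu hv

theorem SatisfiedBy.of_defEquiv {M : Type} {op : M → M → M} {L L' : MagmaLaw}
    (h : L.SatisfiedBy op) (hL : L.DefEquiv L') : L'.SatisfiedBy op := by
  obtain ⟨σ, rfl | rfl⟩ := hL <;> intro f
  · exact (wordValue_map op f σ _).trans ((h _).trans (wordValue_map op f σ _).symm)
  · exact (wordValue_map op f σ _).trans ((h _).symm.trans (wordValue_map op f σ _).symm)

theorem wordValue_dualWord {M : Type} (op : M → M → M) (f : ℕ → M) (w : FreeMagma ℕ) :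
    wordValue op f (dualWord w) = wordValue (fun x y => op y x) f w := by
  induction w using FreeMagma.rec with
  | of => rfl
  | mul u v hu hv => exact congrArg₂ op hv hu

theorem satisfiedBy_dual {M : Type} {op : M → M → M} {L : MagmaLaw} :
    L.dual.SatisfiedBy op ↔ L.SatisfiedBy fun x y => op y x := by
  simp only [SatisfiedBy, dual, wordValue_dualWord]

theorem map_perm_symm (σ : Equiv.Perm ℕ) (w : FreeMagma ℕ) :
    FreeMagma.map σ.symm (FreeMagma.map σ w) = w := by
  induction w using FreeMagma.rec with
  | of i => exact congrArg FreeMagma.of (σ.symm_apply_apply i)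
  | mul u v hu hv => exact congrArg₂ FreeMagma.mul hu hv

theorem DefEquiv.symm {L L' : MagmaLaw} (h : L.DefEquiv L') : L'.DefEquiv L := by
  obtain ⟨σ, rfl | rfl⟩ := h
  · exact ⟨σ.symm, .inl (by simp [relabel, map_perm_symm])⟩
  · exact ⟨σ.symm, .inr (by simp [relabel, MagmaLaw.symm, map_perm_symm])⟩

theorem HasFullSpectrum.of_forall {L : MagmaLaw}
    (h : ∀ n, 0 < n → ∃ (M : Type) (_ : Finite M) (op : M → M → M),
      Nat.card M = n ∧ L.SatisfiedBy op) : L.HasFullSpectrum :=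
  Set.ext fun n => ⟨fun hn => hn.1, fun hn => ⟨hn, h n hn⟩⟩

theorem HasFullSpectrum.exists_model {L : MagmaLaw} (h : L.HasFullSpectrum) {n : ℕ} (hn : 0 < n) :
    ∃ (M : Type) (_ : Finite M) (op : M → M → M), Nat.card M = n ∧ L.SatisfiedBy op :=
  (h.ge hn : n ∈ L.spectrum).2

theorem HasFullSpectrum.mem_spectrum {L : MagmaLaw} (h : L.HasFullSpectrum) {n : ℕ} (hn : 0 < n) :
    n ∈ L.spectrum :=
  ⟨hn, h.exists_model hn⟩

theorem HasFullSpectrum.of_defEquiv {L L' : MagmaLaw} (h : L.HasFullSpectrum)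
    (hL : L.DefEquiv L') : L'.HasFullSpectrum :=
  .of_forall fun _ hn =>
    let ⟨M, hM, op, hc, hs⟩ := h.exists_model hn
    ⟨M, hM, op, hc, hs.of_defEquiv hL⟩

theorem HasFullSpectrum.dual {L : MagmaLaw} (h : L.HasFullSpectrum) : L.dual.HasFullSpectrum :=
  .of_forall fun _ hn =>
    let ⟨M, hM, op, hc, hs⟩ := h.exists_model hn
    ⟨M, hM, fun x y => op y x, hc, satisfiedBy_dual.2 hs⟩

theorem HasLinearModels.hasFullSpectrum {L : MagmaLaw} (h : L.HasLinearModels) :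
    L.HasFullSpectrum :=
  let ⟨_, _, _, _, h⟩ := h
  .of_forall fun n hn =>
    have : NeZero n := ⟨hn.ne'⟩
    ⟨ZMod n, inferInstance, _, Nat.card_zmod n, h n hn⟩

/-- `L` is satisfied by an operation `a x + b y` modulo `3`. -/
def HasLinearModelModThree (L : MagmaLaw) : Prop :=
  ∃ a b : ZMod 3, L.SatisfiedBy fun x y => a * x + b * y

theorem HasLinearModels.modThree {L : MagmaLaw} (h : L.HasLinearModels) :
    L.HasLinearModelModThree :=
  let ⟨_, _, _, _, h⟩ := h
  ⟨_, _, h 3 (by norm_num)⟩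

theorem HasLinearModelModThree.of_defEquiv {L L' : MagmaLaw} (h : L.HasLinearModelModThree)
    (hL : L.DefEquiv L') : L'.HasLinearModelModThree :=
  let ⟨a, b, h⟩ := h
  ⟨a, b, h.of_defEquiv hL⟩

theorem HasLinearModelModThree.of_dual {L : MagmaLaw} (h : L.dual.HasLinearModelModThree) :
    L.HasLinearModelModThree := by
  obtain ⟨a, b, h⟩ := h
  refine ⟨b, a, ?_⟩
  simpa only [add_comm] using satisfiedBy_dual.1 h

/-! ### The three exceptional laws -/

theorem satisfiedBy_E1482_iff {M : Type} {op : M → M → M} :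
    E1482.SatisfiedBy op ↔ ∀ x y, x = op (op y x) (op x (op y y)) :=
  ⟨fun h x y => h fun i => if i = 0 then x else y, fun h f => h (f 0) (f 1)⟩

theorem satisfiedBy_E1523_iff {M : Type} {op : M → M → M} :
    E1523.SatisfiedBy op ↔ ∀ x y z, x = op (op y y) (op x (op z z)) :=
  ⟨fun h x y z => h fun i => if i = 0 then x else if i = 1 then y else z,
    fun h f => h (f 0) (f 1) (f 2)⟩

theorem satisfiedBy_E1682_iff {M : Type} {op : M → M → M} :
    E1682.SatisfiedBy op ↔ ∀ x y, x = op (op y x) (op (op x x) y) :=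
  ⟨fun h x y => h fun i => if i = 0 then x else y, fun h f => h (f 0) (f 1)⟩

/-- All squares are `0` and `0` is a two-sided identity, so the right-hand side becomes `0 ◇ (x ◇ 0)
= x`. The remaining products do not matter. -/
theorem hasFullSpectrum_E1523 : E1523.HasFullSpectrum := by
  refine .of_forall fun n hn => ?_
  have : NeZero n := ⟨hn.ne'⟩
  refine ⟨Fin n, inferInstance,
    fun x y => if x = y then 0 else if x = 0 then y else if y = 0 then x else 0, by simp,
    satisfiedBy_E1523_iff.2 fun x y z => ?_⟩
  by_cases hx : x = 0
  · simp [hx]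
  · simp [hx, Ne.symm hx]

/-- A model of `x ≃ (y ◇ x) ◇ (x ◇ (y ◇ y))` from two different elements. -/
theorem satisfiedBy_E1482_of_ne {M : Type} [DecidableEq M] {z o : M} (h : z ≠ o) :
    E1482.SatisfiedBy fun x y : M =>
      if x = z then Equiv.swap z o y else if y = z then Equiv.swap z o x else z := by
  refine satisfiedBy_E1482_iff.2 fun x y => ?_
  -- The element `z` acts from either side as the transposition of `z` and `o`, and two elements
  -- other than `z` have product `z`. If `x` and `y` differ from `z`, then `y ◇ x = y ◇ y = z`, and
  -- the transposition is applied to `x` twice. The other cases turn on whether the remaining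
  -- element is `o`.
  by_cases hy : y = z
  · subst hy
    by_cases hx : x = y
    · simp [hx, h.symm]
    · by_cases hx' : x = o
      · simp [hx', h.symm]
      · simp [hx, hx', Equiv.swap_apply_of_ne_of_ne, h.symm]
  · by_cases hx : x = z
    · subst hx
      by_cases hy' : y = o
      · simp [hy', h.symm]
      · simp [hy, hy', Equiv.swap_apply_of_ne_of_ne, h.symm]
    · simp [hx, hy]

theorem hasFullSpectrum_E1482 : E1482.HasFullSpectrum := by
  refine .of_forall fun n hn => ?_
  rcases Nat.lt_or_ge 1 n with h | h
  · exact ⟨Fin n, inferInstance, _, by simp,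
      satisfiedBy_E1482_of_ne (z := ⟨0, hn⟩) (o := ⟨1, h⟩) (by simp)⟩
  · obtain rfl : n = 1 := by omega
    exact ⟨Unit, inferInstance, fun _ _ => (), by simp, fun _ => rfl⟩

/-- A square root of the exchange of two different elements of `α` yields an idempotent operation
with `(y ◇ x) ◇ (x ◇ y) = x`. -/
theorem exists_idempotent_of_sq_eq_swap {α : Type} [DecidableEq α]
    (φ : {p : α × α // p.1 ≠ p.2} → {p : α × α // p.1 ≠ p.2})
    (hφ : ∀ p, (φ (φ p)).1 = p.1.swap) :
    ∃ op : α → α → α, (∀ x, op x x = x) ∧ ∀ x y, op (op y x) (op x y) = x := by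
  let op : α → α → α := fun x y => if h : x ≠ y then (φ ⟨(x, y), h⟩).1.1 else x
  have hop : ∀ p : {p : α × α // p.1 ≠ p.2}, op p.1.1 p.1.2 = (φ p).1.1 :=
    fun p => dif_pos p.2
  -- Since `φ` commutes with its square, it commutes with the exchange. So `φ (x, y) = (x ◇ y, y ◇
  -- x)`, and applying `φ` once more gives the required identity.
  have hop' : ∀ p : {p : α × α // p.1 ≠ p.2}, op p.1.2 p.1.1 = (φ p).1.2 := by
    intro p
    have h1 : φ (φ p) = ⟨p.1.swap, p.2.symm⟩ := Subtype.ext (hφ p)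
    have h2 := hop (φ (φ p))
    rw [hφ (φ p)] at h2
    rw [h1] at h2
    exact h2
  have hid : ∀ x, op x x = x := fun x => dif_neg fun h => h rfl
  refine ⟨op, hid, fun x y => ?_⟩
  by_cases hxy : x = y
  · rw [hxy, hid, hid]
  · have h1 := hop ⟨(x, y), hxy⟩
    have h2 := hop' ⟨(x, y), hxy⟩
    dsimp only at h1 h2
    rw [h1, h2, hop', hφ]
    rfl

/-- The pairs of different elements, as unordered pairs together with an orientation. -/
def pairsEquiv (α : Type) [LinearOrder α] :
    {p : α × α // p.1 ≠ p.2} ≃ {p : α × α // p.1 < p.2} × Bool where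
  toFun p := if h : p.1.1 < p.1.2 then (⟨p.1, h⟩, false)
    else (⟨p.1.swap, lt_of_le_of_ne (not_lt.1 h) p.2.symm⟩, true)
  invFun q := bif q.2 then ⟨q.1.1.swap, q.1.2.ne'⟩ else ⟨q.1.1, q.1.2.ne⟩
  left_inv p := by
    by_cases h : p.1.1 < p.1.2 <;> simp [h]
  right_inv q := by
    obtain ⟨⟨⟨x, y⟩, h⟩, b⟩ := q
    have h : x < y := h
    cases b <;> simp [h, h.not_gt]

theorem pairsEquiv_symm_not {α : Type} [LinearOrder α] (s : {p : α × α // p.1 < p.2}) (b : Bool) :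
    ((pairsEquiv α).symm (s, !b)).1 = ((pairsEquiv α).symm (s, b)).1.swap := by
  cases b <;> rfl

theorem card_pairs (n : ℕ) :
    2 * Fintype.card {p : Fin n × Fin n // p.1 < p.2} = n * n - n := by
  have h1 := Fintype.card_congr (pairsEquiv (Fin n))
  rw [Fintype.card_prod, Fintype.card_bool, Fintype.card_subtype] at h1
  have h2 := Finset.offDiag_card (Finset.univ : Finset (Fin n))
  rw [Finset.card_univ, Fintype.card_fin] at h2
  rw [mul_comm, ← h1, ← h2]
  congr 1
  ext p
  simp

/-- The exchange of coordinates consists of `n (n - 1) / 2` transpositions of ordered pairs. For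
these `n` the number is even, so they can be joined two by two into 4-cycles whose square is the
exchange. -/
theorem exists_idempotent {n : ℕ} (hn : n % 4 = 0 ∨ n % 4 = 1) :
    ∃ op : Fin n → Fin n → Fin n, (∀ x, op x x = x) ∧ ∀ x y, op (op y x) (op x y) = x := by
  have hc := card_pairs n
  obtain ⟨m, hm⟩ : ∃ m, Fintype.card {p : Fin n × Fin n // p.1 < p.2} = m * 2 := by
    rcases hn with h | h
    · obtain ⟨k, rfl⟩ : ∃ k, n = 4 * k := ⟨n / 4, by omega⟩
      have : 4 * k * (4 * k) = 4 * (k * (4 * k)) := by ring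
      exact ⟨k * (4 * k) - k, by omega⟩
    · obtain ⟨k, rfl⟩ : ∃ k, n = 4 * k + 1 := ⟨n / 4, by omega⟩
      have : (4 * k + 1) * (4 * k + 1) = 4 * (k * (4 * k) + 2 * k) + 1 := by ring
      exact ⟨k * (4 * k) + k, by omega⟩
  -- Groups the unordered pairs in twos; the Boolean tells the two members of a group apart.
  let ε : {p : Fin n × Fin n // p.1 < p.2} ≃ Fin m × Bool :=
    Fintype.equivOfCardEq (by simp [hm])
  -- Each application passes to the other member of the group, and the orientation is reversed on
  -- one of the two passages, so `ψ` applied twice reverses it once.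
  let ψ : {p : Fin n × Fin n // p.1 < p.2} × Bool → {p : Fin n × Fin n // p.1 < p.2} × Bool :=
    fun q => (ε.symm ((ε q.1).1, !(ε q.1).2), xor (ε q.1).2 q.2)
  have hψ : ∀ q, ψ (ψ q) = (q.1, !q.2) := by
    rintro ⟨s, c⟩
    simp only [ψ, Equiv.apply_symm_apply, Bool.not_not, Prod.mk.eta, Equiv.symm_apply_apply]
    cases (ε s).2 <;> cases c <;> rfl
  refine exists_idempotent_of_sq_eq_swap
    (fun p => (pairsEquiv _).symm (ψ (pairsEquiv _ p))) fun p => ?_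
  simp only [Equiv.apply_symm_apply]
  rw [hψ, pairsEquiv_symm_not, Prod.mk.eta, Equiv.symm_apply_apply]

/-- Two elements are added to an idempotent magma with `(y ◇ x) ◇ (x ◇ y) = x`. -/
def extendOp {α : Type} (op : α → α → α) : Bool ⊕ α → Bool ⊕ α → Bool ⊕ α
  | .inl a, .inl b => .inl (a == b)
  | .inl false, .inr x => .inr x
  | .inl true, .inr _ => .inl false
  | .inr _, .inl false => .inl true
  | .inr x, .inl true => .inr x
  | .inr x, .inr y => .inr (op x y)

theorem satisfiedBy_E1682_extendOp {α : Type} {op : α → α → α} (h : ∀ x, op x x = x)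
    (h' : ∀ x y, op (op y x) (op x y) = x) : E1682.SatisfiedBy (extendOp op) := by
  refine satisfiedBy_E1682_iff.2 fun x y => ?_
  rcases x with (_ | _) | x <;> rcases y with (_ | _) | y <;> simp [extendOp, h, h']

/-- For `n` congruent to 2 or 3 modulo 4, `n - 2` is congruent to 0 or 1, and the two missing
elements are added by `extendOp`. -/
theorem hasFullSpectrum_E1682 : E1682.HasFullSpectrum := by
  refine .of_forall fun n hn => ?_
  by_cases hm : n % 4 = 0 ∨ n % 4 = 1
  · obtain ⟨op, h, h'⟩ := exists_idempotent hm
    exact ⟨Fin n, inferInstance, op, by simp, satisfiedBy_E1682_iff.2 fun x y => by rw [h, h']⟩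
  · obtain ⟨k, rfl⟩ : ∃ k, n = 2 + k := ⟨n - 2, by omega⟩
    obtain ⟨op, h, h'⟩ := exists_idempotent (n := k) (by omega)
    exact ⟨Bool ⊕ Fin k, inferInstance, extendOp op, by simp, satisfiedBy_E1682_extendOp h h'⟩

/-- The residues modulo 3 are `-1`, `0` and `1`, so nine operations have to be excluded. Modulo 2
this would fail for `E1523`, which `x + y` satisfies. -/
theorem not_hasLinearModelModThree_E1482 : ¬ E1482.HasLinearModelModThree := by
  rintro ⟨a, b, h⟩
  replace h := satisfiedBy_E1482_iff.1 h
  revert a b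
  decide

theorem not_hasLinearModelModThree_E1523 : ¬ E1523.HasLinearModelModThree := by
  rintro ⟨a, b, h⟩
  replace h := satisfiedBy_E1523_iff.1 h
  revert a b
  decide

theorem not_hasLinearModelModThree_E1682 : ¬ E1682.HasLinearModelModThree := by
  rintro ⟨a, b, h⟩
  replace h := satisfiedBy_E1682_iff.1 h
  revert a b
  decide

theorem IsExceptional.hasFullSpectrum {L : MagmaLaw} (h : L.IsExceptional) :
    L.HasFullSpectrum := by
  obtain ⟨E, hE, hL⟩ := h
  have hf : E.HasFullSpectrum := by
    rcases hE with rfl | rfl | rfl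
    exacts [hasFullSpectrum_E1482, hasFullSpectrum_E1523, hasFullSpectrum_E1682]
  exact hL.elim hf.of_defEquiv hf.dual.of_defEquiv

theorem IsExceptional.not_hasLinearModels {L : MagmaLaw} (h : L.IsExceptional) :
    ¬ L.HasLinearModels := by
  intro hl
  obtain ⟨E, hE, hL⟩ := h
  have hm : E.HasLinearModelModThree := hL.elim (fun h => hl.modThree.of_defEquiv h.symm)
    fun h => (hl.modThree.of_defEquiv h.symm).of_dual
  rcases hE with rfl | rfl | rfl
  exacts [not_hasLinearModelModThree_E1482 hm, not_hasLinearModelModThree_E1523 hm,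
    not_hasLinearModelModThree_E1682 hm]

/-! ### The classification -/

/-- Equality of words, as a Boolean. -/
def eqWord : FreeMagma ℕ → FreeMagma ℕ → Bool
  | .of i, .of j => Nat.beq i j
  | .of _, .mul _ _ => false
  | .mul _ _, .of _ => false
  | .mul u v, .mul u' v' => bif eqWord u u' then eqWord v v' else false

theorem eqWord_iff (u : FreeMagma ℕ) : ∀ v, eqWord u v = true ↔ u = v := by
  induction u using FreeMagma.rec with
  | of i =>
    intro v
    cases v with
    | of j =>
      rw [eqWord, Nat.beq_eq]
      exact ⟨fun h => h ▸ rfl, fun h => by injection h⟩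
    | mul => simp [eqWord]
  | mul u v hu hv =>
    intro w
    cases w with
    | of => simp [eqWord]
    | mul u' v' =>
      have hm : FreeMagma.mul u v = FreeMagma.mul u' v' ↔ u = u' ∧ v = v' :=
        ⟨fun h => by injection h with h1 h2; exact ⟨h1, h2⟩, fun h => by rw [h.1, h.2]⟩
      rw [eqWord, Bool.cond_eq_ite, hm, ← hu, ← hv]
      split_ifs <;> simp_all

/-- The right-hand sides of the listed laws that are definitionally equivalent to an exceptional law
or its dual; the left-hand sides are `0`. -/
def exceptionalSides : List (FreeMagma ℕ) :=
  [.mul (.mul (.of 1) (.of 0)) (.mul (.of 0) (.mul (.of 1) (.of 1))),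
    .mul (.mul (.of 1) (.of 1)) (.mul (.of 0) (.mul (.of 2) (.of 2))),
    .mul (.mul (.of 1) (.of 0)) (.mul (.mul (.of 0) (.of 0)) (.of 1)),
    .mul (.mul (.mul (.of 1) (.of 1)) (.of 0)) (.mul (.of 0) (.of 1)),
    .mul (.mul (.mul (.of 1) (.of 1)) (.of 0)) (.mul (.of 2) (.of 2)),
    .mul (.mul (.of 1) (.mul (.of 0) (.of 0))) (.mul (.of 0) (.of 1))]

/-- Is the law `u ≃ v` one of those given by `exceptionalSides`? -/
def isExceptional (u v : FreeMagma ℕ) : Bool :=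
  bif eqWord u (.of 0) then exceptionalSides.any (eqWord v) else false

theorem isExceptional_iff {u v : FreeMagma ℕ} :
    isExceptional u v = true ↔ u = .of 0 ∧ v ∈ exceptionalSides := by
  rw [isExceptional, Bool.cond_eq_ite, ← eqWord_iff u]
  split_ifs with h <;> simp [h, eqWord_iff]

/-- The kind of a listed law of order at most `4`: linear models (`0`), exceptional (`1`), no model
of size `2` (`2`), a model of size `2` but none of size `3` (`3`). -/
noncomputable def kind (u v : FreeMagma ℕ) : ℕ :=
  bif isLinear u v then 0
  else bif noModel [0, 1] u v then 2
  else bif isExceptional u v then 1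
  else bif noModel [0, 1, 2] u v then
    bif isModel [0, 1] xorTable u v then 3 else bif isModel [0, 1] norTable u v then 3 else 4
  else 4

theorem lawSum_one : (lawSum 4 fun _ _ => 1) = 4694 := by decide +kernel

/-- The numbers of laws of each kind are the digits of a single sum, so one pass over the list
yields all of them. The base exceeds 4694, the length of the list. -/
theorem lawSum_kind : (lawSum 4 fun u v => 10000 ^ kind u v) =
    3068 + 6 * 10000 + 1558 * 10000 ^ 2 + 62 * 10000 ^ 3 := by
  decide +kernel

/-- The order on laws with sides of different shapes, as a Boolean. -/
def ltShapes (s t s' t' : FreeMagma Unit) : Bool :=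
  bif Nat.blt (wordOrder s + wordOrder t) (wordOrder s' + wordOrder t') then true
  else bif Nat.beq (wordOrder s + wordOrder t) (wordOrder s' + wordOrder t') then
    bif ltShape s s' then true else bif eqShape s s' then ltShape t t' else false
  else false

/-- The number of listed laws of order at most `4` that precede the law with sides of the shapes
`s` and `t` and with the string of indeterminates `l`. -/
def numBefore (s t : FreeMagma Unit) (l : List ℕ) : ℕ :=
  ((shapePairs 4).map fun p =>
    bif ltShapes p.1 p.2 s t then (stringsOfShapes p.1 p.2).length
    else bif eqShape p.1 s then
      bif eqShape p.2 t then (stringsOfShapes p.1 p.2).countP fun k => ltVars k l else 0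
    else 0).sum

theorem numBefore_E1482 :
    numBefore (wordShape E1482.lhs) (wordShape E1482.rhs) E1482.vars = 1481 := by
  decide +kernel

theorem numBefore_E1523 :
    numBefore (wordShape E1523.lhs) (wordShape E1523.rhs) E1523.vars = 1522 := by
  decide +kernel

theorem numBefore_E1682 :
    numBefore (wordShape E1682.lhs) (wordShape E1682.rhs) E1682.vars = 1681 := by
  decide +kernel

/-! ### The listed representatives of the exceptional laws. -/

theorem eq_of_canon_vars {L : MagmaLaw} (hL : L.IsListed) {u v u' v' : FreeMagma ℕ} {i : ℕ}
    (h : DefEquiv ⟨.of i, .mul u v⟩ L) (hs : wordShape (.mul u v) = wordShape (.mul u' v'))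
    (hv : canon (MagmaLaw.vars ⟨.of i, .mul u v⟩) = MagmaLaw.vars ⟨.of 0, .mul u' v'⟩) :
    L = ⟨.of 0, .mul u' v'⟩ := by
  obtain ⟨h1, h2, h3⟩ := eq_of_defEquiv_of_isListed hL h
  rw [← ofShapes_self L, h1, h2, h3, hv, hs]
  exact ofShapes_self ⟨.of 0, .mul u' v'⟩

theorem IsExceptional.exists_eq {L : MagmaLaw} (hL : L.IsListed) (h : L.IsExceptional) :
    ∃ (k : ℕ) (hk : k < exceptionalSides.length), L = ⟨.of 0, exceptionalSides[k]⟩ := by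
  obtain ⟨E, rfl | rfl | rfl, h | h⟩ := h
  -- The first three entries of `exceptionalSides` belong to the laws themselves, the last three in
  -- the same order to their duals.
  · exact ⟨0, by decide, eq_of_canon_vars hL h rfl (by decide)⟩
  · exact ⟨3, by decide, eq_of_canon_vars hL h rfl (by decide)⟩
  · exact ⟨1, by decide, eq_of_canon_vars hL h rfl (by decide)⟩
  · exact ⟨4, by decide, eq_of_canon_vars hL h rfl (by decide)⟩
  · exact ⟨2, by decide, eq_of_canon_vars hL h rfl (by decide)⟩
  · exact ⟨5, by decide, eq_of_canon_vars hL h rfl (by decide)⟩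

theorem map_one (w : FreeMagma ℕ) : FreeMagma.map (1 : Equiv.Perm ℕ) w = w := by
  induction w using FreeMagma.rec with
  | of => rfl
  | mul u v hu hv => exact congrArg₂ FreeMagma.mul hu hv

theorem DefEquiv.refl (L : MagmaLaw) : L.DefEquiv L :=
  ⟨1, .inl (by simp only [relabel, map_one])⟩

theorem isExceptional_of_mem {v : FreeMagma ℕ} (h : v ∈ exceptionalSides) :
    IsExceptional ⟨.of 0, v⟩ := by
  simp only [exceptionalSides, List.mem_cons, List.not_mem_nil, or_false] at h
  rcases h with rfl | rfl | rfl | rfl | rfl | rfl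
  · exact ⟨E1482, by simp, .inl (.refl _)⟩
  · exact ⟨E1523, by simp, .inl (.refl _)⟩
  · exact ⟨E1682, by simp, .inl (.refl _)⟩
  · exact ⟨E1482, by simp, .inr (.refl _)⟩
  -- Here the dual has the string `0, 2, 2, 0, 1, 1`, which is not canonical.
  · exact ⟨E1523, by simp, .inr ⟨Equiv.swap 1 2, .inl rfl⟩⟩
  · exact ⟨E1682, by simp, .inr (.refl _)⟩

theorem isExceptional_iff_isExceptional {L : MagmaLaw} (hL : L.IsListed) :
    L.IsExceptional ↔ isExceptional L.lhs L.rhs = true := by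
  rw [isExceptional_iff]
  constructor
  · intro h
    obtain ⟨k, hk, rfl⟩ := h.exists_eq hL
    exact ⟨rfl, List.getElem_mem hk⟩
  · obtain ⟨u, v⟩ := L
    rintro ⟨rfl, h⟩
    exact isExceptional_of_mem h

/-! ### Reading off the numbers of laws of each kind. -/

theorem sum_pow_eq {α : Type} {κ : α → ℕ} (h : ∀ x, κ x ≤ 4) (l : List α) :
    (l.map fun x => 10000 ^ κ x).sum =
      l.countP (fun x => κ x == 0) + l.countP (fun x => κ x == 1) * 10000 +
      l.countP (fun x => κ x == 2) * 10000 ^ 2 + l.countP (fun x => κ x == 3) * 10000 ^ 3 +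
      l.countP (fun x => κ x == 4) * 10000 ^ 4 := by
  induction l with
  | nil => simp
  | cons x l ih =>
    rw [List.map_cons, List.sum_cons, ih]
    simp only [List.countP_cons, beq_iff_eq]
    have := h x
    generalize κ x = c at this
    obtain rfl | rfl | rfl | rfl | rfl : c = 0 ∨ c = 1 ∨ c = 2 ∨ c = 3 ∨ c = 4 := by omega
    all_goals
      simp only [OfNat.ofNat_ne_zero, OfNat.zero_ne_ofNat, OfNat.ofNat_ne_one, OfNat.one_ne_ofNat,
        Nat.reduceEqDiff, zero_ne_one, one_ne_zero, if_true, if_false]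
      ring

theorem countP_eq_of_sum_pow_eq {α : Type} {κ : α → ℕ} (h : ∀ x, κ x ≤ 4) {l : List α}
    (hl : l.length = 4694) (hs : (l.map fun x => 10000 ^ κ x).sum =
      3068 + 6 * 10000 + 1558 * 10000 ^ 2 + 62 * 10000 ^ 3) :
    l.countP (fun x => κ x == 0) = 3068 ∧ l.countP (fun x => κ x == 1) = 6 ∧
      l.countP (fun x => κ x == 2) = 1558 ∧ l.countP (fun x => κ x == 3) = 62 ∧
      l.countP (fun x => κ x == 4) = 0 := by
  rw [sum_pow_eq h] at hs
  -- Bounds on the four lower digits make the expansion in base 10000 unique.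
  have hb : ∀ i, l.countP (fun x => κ x == i) ≤ 4694 := fun i =>
    List.countP_le_length.trans_eq hl
  have h0 := hb 0
  have h1 := hb 1
  have h2 := hb 2
  have h3 := hb 3
  omega

theorem kind_le (u v : FreeMagma ℕ) : kind u v ≤ 4 := by
  simp only [kind, Bool.cond_eq_ite]
  split_ifs <;> omega

theorem length_lawList : (lawList 4).length = 4694 := by
  rw [← lawSum_one, lawSum_eq]
  simp

theorem countP_kind :
    (lawList 4).countP (fun L => kind L.lhs L.rhs == 0) = 3068 ∧
    (lawList 4).countP (fun L => kind L.lhs L.rhs == 1) = 6 ∧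
    (lawList 4).countP (fun L => kind L.lhs L.rhs == 2) = 1558 ∧
    (lawList 4).countP (fun L => kind L.lhs L.rhs == 3) = 62 ∧
    (lawList 4).countP (fun L => kind L.lhs L.rhs == 4) = 0 :=
  countP_eq_of_sum_pow_eq (fun _ => kind_le _ _) length_lawList
    ((lawSum_eq 4 fun u v => 10000 ^ kind u v).symm.trans lawSum_kind)

/-- The digit for kind `4` vanishes, so every law has a certificate. -/
theorem kind_lt {L : MagmaLaw} (hL : L ∈ lawsUpToFour) : kind L.lhs L.rhs < 4 := by
  have h4 := kind_le L.lhs L.rhs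
  refine lt_of_le_of_ne h4 fun h => ?_
  have := List.countP_eq_zero.1 countP_kind.2.2.2.2 L (mem_lawList.2 hL)
  exact this (beq_iff_eq.2 h)

/-- The tests that `kind` applies before `isExceptional` must fail, because they are sound and an
exceptional law has no linear models but full spectrum. -/
theorem IsExceptional.kind_eq {L : MagmaLaw} (hL : L ∈ lawsUpToFour) (h : L.IsExceptional) :
    kind L.lhs L.rhs = 1 := by
  have h1 : isLinear L.lhs L.rhs = false := Bool.eq_false_iff.2 fun h' =>
    h.not_hasLinearModels (hasLinearModels_of_isLinear hL.2 h')
  have h2 : noModel [0, 1] L.lhs L.rhs = false := Bool.eq_false_iff.2 fun h' =>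
    notMem_spectrum_of_noModel (n := 2) h' (h.hasFullSpectrum.mem_spectrum two_pos)
  rw [kind, h1, h2, (isExceptional_iff_isExceptional hL.1).1 h]
  rfl

/-- The properties of a law of given kind. -/
theorem kind_spec {L : MagmaLaw} (hL : L ∈ lawsUpToFour) :
    (kind L.lhs L.rhs = 0 ∧ L.HasLinearModels ∧ ¬ L.IsExceptional ∧ L.HasFullSpectrum) ∨
    (kind L.lhs L.rhs = 1 ∧ ¬ L.HasLinearModels ∧ L.IsExceptional ∧ L.HasFullSpectrum) ∨
    (kind L.lhs L.rhs = 2 ∧ 2 ∉ L.spectrum) ∨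
    (kind L.lhs L.rhs = 3 ∧ 2 ∈ L.spectrum ∧ 3 ∉ L.spectrum) := by
  have hk := kind_lt hL
  by_cases hE : L.IsExceptional
  · exact .inr (.inl ⟨hE.kind_eq hL, hE.not_hasLinearModels, hE, hE.hasFullSpectrum⟩)
  rw [isExceptional_iff_isExceptional hL.1, Bool.not_eq_true] at hE
  rw [kind, hE] at hk ⊢
  rw [isExceptional_iff_isExceptional hL.1, hE]
  cases h1 : isLinear L.lhs L.rhs
  · cases h2 : noModel [0, 1] L.lhs L.rhs
    · cases h3 : noModel [0, 1, 2] L.lhs L.rhs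
      -- This combination has kind `4`, which `hk` excludes.
      · simp [h1, h2, h3] at hk
      · have hm : isModel [0, 1] xorTable L.lhs L.rhs = true ∨
            isModel [0, 1] norTable L.lhs L.rhs = true := by
          by_contra! hc
          simp [h1, h2, h3, hc] at hk
        refine .inr (.inr (.inr ⟨?_, two_mem_spectrum hm,
          notMem_spectrum_of_noModel (n := 3) h3⟩))
        rcases hm with hm | hm <;> simp [hm]
    · exact .inr (.inr (.inl ⟨rfl, notMem_spectrum_of_noModel (n := 2) h2⟩))
  · have hl := hasLinearModels_of_isLinear hL.2 h1
    exact .inl ⟨rfl, hl, by simp, hl.hasFullSpectrum⟩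

/-! ### The numbers of the exceptional laws -/

theorem lt_iff (L L' : MagmaLaw) : L.LT L' ↔
    ltShapes (wordShape L.lhs) (wordShape L.rhs) (wordShape L'.lhs) (wordShape L'.rhs) = true ∨
      L.SameShape L' ∧ L.vars < L'.vars := by
  simp only [LT, ltShapes, order_eq, ← ltShape_iff, ← eqShape_iff, Bool.cond_eq_ite, Nat.blt_eq,
    Nat.beq_eq, ← or_assoc]
  refine or_congr_left ?_
  split_ifs <;> simp_all

theorem length_of_mem_stringsOfShapes {s t : FreeMagma Unit} {l : List ℕ}
    (h : l ∈ stringsOfShapes s t) : l.length = wordOrder s + wordOrder t + 2 := by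
  refine (mem_canonStrings_zero.1 ?_).1
  rw [stringsOfShapes] at h
  cases he : eqShape s t
  · rwa [he] at h
  · rw [he] at h
    exact (List.mem_filter.1 h).1

-- Shapes are compared before strings, so of a block of laws with given shapes either all precede
-- `L`, or none, or, if the shapes are those of `L`, the ones with smaller strings.
open Classical in
theorem countP_lt_lawList (L : MagmaLaw) : (lawList 4).countP (fun L' => LT L' L) =
    numBefore (wordShape L.lhs) (wordShape L.rhs) L.vars := by
  rw [lawList, numBefore, List.countP_flatMap]
  congr 1
  refine List.map_congr_left fun p _ => ?_
  rw [Function.comp_apply, lawsOfShapes, List.countP_map]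
  have hl : ∀ l ∈ stringsOfShapes p.1 p.2, LT (ofShapes p.1 p.2 l) L ↔
      ltShapes p.1 p.2 (wordShape L.lhs) (wordShape L.rhs) = true ∨
        (eqShape p.1 (wordShape L.lhs) = true ∧ eqShape p.2 (wordShape L.rhs) = true) ∧
          ltVars l L.vars = true := by
    intro l hl
    rw [lt_iff, SameShape, vars_ofShapes (length_of_mem_stringsOfShapes hl), ltVars_iff,
      eqShape_iff, eqShape_iff, ofShapes, wordShape_fill, wordShape_fill]
  cases h1 : ltShapes p.1 p.2 (wordShape L.lhs) (wordShape L.rhs)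
  · cases h2 : eqShape p.1 (wordShape L.lhs)
    · exact List.countP_eq_zero.2 fun l h => by simp [hl l h, h1, h2]
    · cases h3 : eqShape p.2 (wordShape L.rhs)
      · exact List.countP_eq_zero.2 fun l h => by simp [hl l h, h1, h3]
      · exact List.countP_congr fun l h => by simp [hl l h, h1, h2, h3]
  · exact List.countP_eq_length.2 fun l h => by simp [hl l h, h1]

/-- A law that precedes `L` has no larger order, so the finite list contains all predecessors. -/
theorem number_eq {L : MagmaLaw} (ho : L.order ≤ 4) :
    L.number = numBefore (wordShape L.lhs) (wordShape L.rhs) L.vars + 1 := by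
  classical
  have hle : ∀ L', LT L' L → L'.order ≤ 4 := by
    rintro L' (h | h | ⟨h, -⟩)
    · omega
    · omega
    · rwa [order_eq, h.1, h.2, ← order_eq]
  rw [number, ← countP_lt_lawList,
    ← ncard_sep_lawsUpToFour (fun L' => LT L' L) _ fun L' _ => by simp]
  congr 2
  ext L'
  exact ⟨fun h => ⟨⟨h.1, hle L' h.2⟩, h.2⟩, fun h => ⟨h.1.1, h.2⟩⟩

theorem mem_lawsUpToFour_of_canon {u v : FreeMagma ℕ} (ho : wordOrder (.mul u v) ≤ 4)
    (hc : canon (MagmaLaw.vars ⟨.of 0, .mul u v⟩) = MagmaLaw.vars ⟨.of 0, .mul u v⟩) :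
    ⟨.of 0, .mul u v⟩ ∈ lawsUpToFour := by
  refine ⟨(isListed_iff _).2 ⟨hc, fun h => h, fun h => ?_, fun h => ?_⟩, ?_⟩
  · exact absurd h nofun
  · exact absurd h nofun
  · simpa [order, wordOrder] using ho

theorem E1482_mem : E1482 ∈ lawsUpToFour := mem_lawsUpToFour_of_canon (by decide) (by decide)

theorem E1523_mem : E1523 ∈ lawsUpToFour := mem_lawsUpToFour_of_canon (by decide) (by decide)

theorem E1682_mem : E1682 ∈ lawsUpToFour := mem_lawsUpToFour_of_canon (by decide) (by decide)

theorem number_E1482 : E1482.number = 1482 := by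
  rw [number_eq E1482_mem.2, numBefore_E1482]

theorem number_E1523 : E1523.number = 1523 := by
  rw [number_eq E1523_mem.2, numBefore_E1523]

theorem number_E1682 : E1682.number = 1682 := by
  rw [number_eq E1682_mem.2, numBefore_E1682]

/-! ### Counting -/

theorem ncard_sep_kind {p : MagmaLaw → Prop} {i : ℕ}
    (h : ∀ L ∈ lawsUpToFour, p L ↔ kind L.lhs L.rhs = i) :
    {L ∈ lawsUpToFour | p L}.ncard = (lawList 4).countP fun L => kind L.lhs L.rhs == i :=
  ncard_sep_lawsUpToFour p _ fun L hL => by rw [h L (mem_lawList.1 hL), beq_iff_eq]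

theorem finite_lawsUpToFour : lawsUpToFour.Finite := by
  rw [lawsUpToFour_eq]
  exact (lawList 4).finite_toSet

theorem ncard_lawsUpToFour : lawsUpToFour.ncard = 4694 := by
  have h := ncard_sep_lawsUpToFour (fun _ => True) (fun _ => true) (by simp)
  rw [List.countP_true, length_lawList] at h
  rw [← h]
  congr 1
  ext L
  simp

theorem HasFullSpectrum.two_three_mem {L : MagmaLaw} (h : L.HasFullSpectrum) :
    2 ∈ L.spectrum ∧ 3 ∈ L.spectrum :=
  ⟨h.mem_spectrum two_pos, h.mem_spectrum three_pos⟩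

theorem hasFullSpectrum_iff {L : MagmaLaw} (hL : L ∈ lawsUpToFour) :
    L.HasFullSpectrum ↔ (L.HasLinearModels ∨ L.IsExceptional) := by
  have := fun h : L.HasFullSpectrum => h.two_three_mem
  have := fun h : L.HasLinearModels => h.hasFullSpectrum
  have := fun h : L.IsExceptional => h.hasFullSpectrum
  rcases kind_spec hL with h | h | h | h <;> tauto

theorem not_hasFullSpectrum_iff {L : MagmaLaw} (hL : L ∈ lawsUpToFour) :
    ¬ L.HasFullSpectrum ↔ (2 ∉ L.spectrum ∨ 3 ∉ L.spectrum) := by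
  have := fun h : L.HasFullSpectrum => h.two_three_mem
  rcases kind_spec hL with h | h | h | h <;> tauto

/-- No other kind admits linear models: kind `1` excludes them outright, and kinds `2` and `3` lack
a model of size 2 or 3. -/
theorem ncard_hasLinearModels : {L ∈ lawsUpToFour | L.HasLinearModels}.ncard = 3068 := by
  rw [ncard_sep_kind (i := 0), countP_kind.1]
  intro L hL
  have := fun h : L.HasLinearModels => h.hasFullSpectrum.two_three_mem
  rcases kind_spec hL with h | h | h | h <;> simp only [h] <;> tauto

theorem ncard_isExceptional : {L ∈ lawsUpToFour | L.IsExceptional}.ncard = 6 := by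
  rw [ncard_sep_kind (i := 1), countP_kind.2.1]
  intro L hL
  have := fun h : L.IsExceptional => h.hasFullSpectrum.two_three_mem
  rcases kind_spec hL with h | h | h | h <;> simp only [h] <;> tauto

theorem ncard_two_notMem_spectrum : {L ∈ lawsUpToFour | 2 ∉ L.spectrum}.ncard = 1558 := by
  rw [ncard_sep_kind (i := 2), countP_kind.2.2.1]
  intro L hL
  have := fun h : L.HasFullSpectrum => h.two_three_mem
  rcases kind_spec hL with h | h | h | h <;> simp only [h] <;> tauto

theorem ncard_three_notMem_spectrum :
    {L ∈ lawsUpToFour | 2 ∈ L.spectrum ∧ 3 ∉ L.spectrum}.ncard = 62 := by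
  rw [ncard_sep_kind (i := 3), countP_kind.2.2.2.1]
  intro L hL
  have := fun h : L.HasFullSpectrum => h.two_three_mem
  rcases kind_spec hL with h | h | h | h <;> simp only [h] <;> tauto

theorem ncard_hasFullSpectrum : {L ∈ lawsUpToFour | L.HasFullSpectrum}.ncard = 3074 := by
  have h : {L ∈ lawsUpToFour | L.HasFullSpectrum} =
      {L ∈ lawsUpToFour | L.HasLinearModels} ∪ {L ∈ lawsUpToFour | L.IsExceptional} := by
    ext L
    exact ⟨fun h => ((hasFullSpectrum_iff h.1).1 h.2).imp (⟨h.1, ·⟩) (⟨h.1, ·⟩),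
      fun h => h.elim (fun h => ⟨h.1, (hasFullSpectrum_iff h.1).2 (.inl h.2)⟩)
        fun h => ⟨h.1, (hasFullSpectrum_iff h.1).2 (.inr h.2)⟩⟩
  rw [h, Set.ncard_union_eq ?_ (finite_lawsUpToFour.subset fun _ h => h.1)
    (finite_lawsUpToFour.subset fun _ h => h.1), ncard_hasLinearModels, ncard_isExceptional]
  exact Set.disjoint_left.2 fun L h h' => h'.2.not_hasLinearModels h.2

theorem ncard_not_hasFullSpectrum : {L ∈ lawsUpToFour | ¬ L.HasFullSpectrum}.ncard = 1620 := by
  have h : {L ∈ lawsUpToFour | ¬ L.HasFullSpectrum} = {L ∈ lawsUpToFour | 2 ∉ L.spectrum} ∪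
      {L ∈ lawsUpToFour | 2 ∈ L.spectrum ∧ 3 ∉ L.spectrum} := by
    ext L
    constructor
    · rintro ⟨h, h'⟩
      by_cases h2 : 2 ∈ L.spectrum
      · exact .inr ⟨h, h2, ((not_hasFullSpectrum_iff h).1 h').resolve_left (not_not.2 h2)⟩
      · exact .inl ⟨h, h2⟩
    · rintro (⟨h, h'⟩ | ⟨h, -, h'⟩)
      · exact ⟨h, (not_hasFullSpectrum_iff h).2 (.inl h')⟩
      · exact ⟨h, (not_hasFullSpectrum_iff h).2 (.inr h')⟩
  rw [h, Set.ncard_union_eq ?_ (finite_lawsUpToFour.subset fun _ h => h.1)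
    (finite_lawsUpToFour.subset fun _ h => h.1), ncard_two_notMem_spectrum,
    ncard_three_notMem_spectrum]
  exact Set.disjoint_left.2 fun L h h' => h.2 h'.2.1

end MagmaLaw

theorem mainTheorem3 :
    -- the listed laws of order at most 4, and the numbers of the three exceptional ones
    MagmaLaw.lawsUpToFour.ncard = 4694 ∧
    (MagmaLaw.E1482 ∈ MagmaLaw.lawsUpToFour ∧ MagmaLaw.E1482.number = 1482) ∧
    (MagmaLaw.E1523 ∈ MagmaLaw.lawsUpToFour ∧ MagmaLaw.E1523.number = 1523) ∧
    (MagmaLaw.E1682 ∈ MagmaLaw.lawsUpToFour ∧ MagmaLaw.E1682.number = 1682) ∧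
    -- the classification
    {L ∈ MagmaLaw.lawsUpToFour | L.HasFullSpectrum}.ncard = 3074 ∧
    {L ∈ MagmaLaw.lawsUpToFour | ¬ L.HasFullSpectrum}.ncard = 1620 ∧
    -- the positive cases
    (∀ L ∈ MagmaLaw.lawsUpToFour,
      L.HasFullSpectrum ↔ (L.HasLinearModels ∨ L.IsExceptional)) ∧
    (∀ L ∈ MagmaLaw.lawsUpToFour, ¬ (L.HasLinearModels ∧ L.IsExceptional)) ∧
    {L ∈ MagmaLaw.lawsUpToFour | L.HasLinearModels}.ncard = 3068 ∧
    {L ∈ MagmaLaw.lawsUpToFour | L.IsExceptional}.ncard = 6 ∧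
    -- the negative cases
    (∀ L ∈ MagmaLaw.lawsUpToFour,
      ¬ L.HasFullSpectrum ↔ (2 ∉ L.spectrum ∨ 3 ∉ L.spectrum)) ∧
    {L ∈ MagmaLaw.lawsUpToFour | 2 ∉ L.spectrum}.ncard = 1558 ∧
    {L ∈ MagmaLaw.lawsUpToFour | 2 ∈ L.spectrum ∧ 3 ∉ L.spectrum}.ncard = 62 := by
  open MagmaLaw in
  exact ⟨ncard_lawsUpToFour, ⟨E1482_mem, number_E1482⟩, ⟨E1523_mem, number_E1523⟩,
    ⟨E1682_mem, number_E1682⟩, ncard_hasFullSpectrum, ncard_not_hasFullSpectrum,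
    fun _ => hasFullSpectrum_iff, fun _ _ h => h.2.not_hasLinearModels h.1,
    ncard_hasLinearModels, ncard_isExceptional, fun _ => not_hasFullSpectrum_iff,
    ncard_two_notMem_spectrum, ncard_three_notMem_spectrum⟩
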